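/- Let $g\ge 3$. Let $\mathbb H_g$ be the Siegel upper half space of symmetric matrices $\tau\in M_g(\mathbb C)$ with $\operatorname{Im}\tau>0$, and let $\Gamma_g=\mathrm{Sp}_{2g}(\mathbb Z)$ act on it by $M.\tau=(A\tau+B)(C\tau+D)^{-1}$ for $M=\begin{pmatrix}A&B\\C&D\end{pmatrix}$. Put $j(M,\tau)=\det(C\tau+D)$ and $$\Gamma_g^0(2)=\{M\in\Gamma_g : B\equiv 0 \pmod 2\}.$$ For $\varepsilon_1,\varepsilon_2\in\mathbb Z^g$ and $\tau\in\mathbb H_g$ let $$\theta\begin{bmatrix}\varepsilon_1\\ \varepsilon_2\end{bmatrix}(\tau)=\sum_{n\in\mathbb Z^g}\exp\Big(\pi i\big({}^t(n+\tfrac{\varepsilon_1}{2})\,\tau\,(n+\tfrac{\varepsilon_1}{2})+{}^t(n+\tfrac{\varepsilon_1}{2})\,\varepsilon_2\big)\Big)$$ be the Thetanullwerte. Let $S_g$ be the set of even characteristics, that is, of the pairs $(\varepsilon_1,\varepsilon_2)$ with $\varepsilon_1,\varepsilon_2\in\{0,1\}^g$ and $\varepsilon_1\cdot\varepsilon_2$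 even, let $k=\#S_g/2$, and let $$\chi_k(\tau)=\prod_{(\varepsilon_1,\varepsilon_2)\in S_g}\theta\begin{bmatrix}\varepsilon_1\\ \varepsilon_2\end{bmatrix}(\tau).$$ Then the function $f(\tau)=\chi_k(\tfrac12\tau)$ is a Siegel modular form of weight $k$ for $\Gamma_g^0(2)$: it is holomorphic on $\mathbb H_g$, and $$f(M.\tau)=j(M,\tau)^k f(\tau)\qquad\text{for all } M\in\Gamma_g^0(2),\ \tau\in\mathbb H_g .$$ -/

import Mathlib

noncomputable section

namespace SiegelTheta

open Matrix

/-- The Siegel upper half space `ℍ_g`: complex symmetric `g × g` matrices with positive definite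
imaginary part. -/
def upperHalfSpace (g : ℕ) : Set (Matrix (Fin g) (Fin g) ℂ) :=
  {τ | τ.IsSymm ∧ (τ.map Complex.im).PosDef}

/-- The Siegel modular group `Γ_g = Sp_{2g}(ℤ)`. -/
abbrev siegelModularGroup (g : ℕ) := Matrix.symplecticGroup (Fin g) ℤ

section Blocks

variable {g : ℕ} (M : siegelModularGroup g)

/-- The block `A` of `M = [A B; C D]`. -/
def blockA : Matrix (Fin g) (Fin g) ℤ := M.1.toBlocks₁₁

/-- The block `B` of `M = [A B; C D]`. -/
def blockB : Matrix (Fin g) (Fin g) ℤ := M.1.toBlocks₁₂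

/-- The block `C` of `M = [A B; C D]`. -/
def blockC : Matrix (Fin g) (Fin g) ℤ := M.1.toBlocks₂₁

/-- The block `D` of `M = [A B; C D]`. -/
def blockD : Matrix (Fin g) (Fin g) ℤ := M.1.toBlocks₂₂

/-- `C τ + D`, as a complex matrix. -/
def denom (τ : Matrix (Fin g) (Fin g) ℂ) : Matrix (Fin g) (Fin g) ℂ :=
  (blockC M).map (Int.cast : ℤ → ℂ) * τ + (blockD M).map (Int.cast : ℤ → ℂ)

/-- `A τ + B`, as a complex matrix. -/
def num (τ : Matrix (Fin g) (Fin g) ℂ) : Matrix (Fin g) (Fin g) ℂ :=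
  (blockA M).map (Int.cast : ℤ → ℂ) * τ + (blockB M).map (Int.cast : ℤ → ℂ)

/-- The action `M.τ = (A τ + B) (C τ + D)⁻¹`. -/
def act (τ : Matrix (Fin g) (Fin g) ℂ) : Matrix (Fin g) (Fin g) ℂ :=
  num M τ * (denom M τ)⁻¹

/-- The automorphy factor `j(M, τ) = det (C τ + D)`. -/
def autFactor (τ : Matrix (Fin g) (Fin g) ℂ) : ℂ := (denom M τ).det

end Blocks

/-- The congruence subgroup `Γ_g^0(2)` of the `M = [A B; C D]` in `Sp_{2g}(ℤ)` with
`B ≡ 0 (mod 2)`. -/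
def Gamma0Upper (g : ℕ) : Subgroup (siegelModularGroup g) where
  carrier := {M | ∀ i j, (2 : ℤ) ∣ blockB M i j}
  one_mem' := by
    intro i j
    simp [blockB, Matrix.toBlocks₁₂]
  mul_mem' := by
    intro M N hM hN i j
    have h : blockB (M * N) i j
        = ∑ l, blockA M i l * blockB N l j + ∑ l, blockB M i l * blockD N l j := by
      simp [blockA, blockB, blockD, Matrix.toBlocks₁₁, Matrix.toBlocks₁₂, Matrix.toBlocks₂₂,
        Matrix.mul_apply]
    rw [h]
    exact dvd_add (Finset.dvd_sum fun l _ => Dvd.dvd.mul_left (hN l j) _)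
      (Finset.dvd_sum fun l _ => Dvd.dvd.mul_right (hM i l) _)
  inv_mem' := by
    intro M hM i j
    have h : blockB M⁻¹ = -(blockB M)ᵀ := by
      have h1 : (M⁻¹).1 = (-J (Fin g) ℤ) * (M.1)ᵀ * J (Fin g) ℤ := SymplecticGroup.coe_inv M
      unfold blockB
      rw [h1]
      conv_lhs => rw [← Matrix.fromBlocks_toBlocks M.1]
      simp [J, Matrix.fromBlocks_transpose, Matrix.fromBlocks_neg, Matrix.fromBlocks_multiply]
    rw [h]
    simpa using hM j i

/-- `f` is a Siegel modular form of genus `g` and weight `w` for the group `Γ`, where `g ≥ 2`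
(so that no condition at the cusps is needed): `f` is holomorphic on `ℍ_g` and satisfies
`f(M.τ) = j(M, τ)^w f(τ)`. Only the values of `f` on `ℍ_g` matter.

`ℍ_g` is open in the space of symmetric matrices, and every linear form on symmetric matrices
extends to all matrices, so `DifferentiableOn ℂ f (upperHalfSpace g)` (derivatives within `ℍ_g`)
means precisely that `f` is holomorphic in the coordinates `τ i j`, `i ≤ j`. -/
structure IsSiegelModularForm {g : ℕ} (Γ : Subgroup (siegelModularGroup g)) (w : ℕ)
    (f : Matrix (Fin g) (Fin g) ℂ → ℂ) : Prop where
  holomorphic : DifferentiableOn ℂ f (upperHalfSpace g)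
  transform : ∀ M ∈ Γ, ∀ τ ∈ upperHalfSpace g, f (act M τ) = autFactor M τ ^ w * f τ

/-- `n + ε / 2`. -/
def shifted {g : ℕ} (ε n : Fin g → ℤ) : Fin g → ℂ := fun i => (n i : ℂ) + (ε i : ℂ) / 2

/-- The general term of the theta series, that is
`exp (π i ((n + ε₁/2) τ (n + ε₁/2) + 2 (n + ε₁/2) (z + ε₂/2)))`. -/
def thetaTerm {g : ℕ} (ε₁ ε₂ : Fin g → ℤ) (z : Fin g → ℂ) (τ : Matrix (Fin g) (Fin g) ℂ)
    (n : Fin g → ℤ) : ℂ :=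
  Complex.exp (Real.pi * Complex.I *
    (shifted ε₁ n ⬝ᵥ τ *ᵥ shifted ε₁ n
      + 2 * (shifted ε₁ n ⬝ᵥ fun i => z i + (ε₂ i : ℂ) / 2)))

/-- A positive definite real quadratic form is bounded below by a multiple of `∑ xᵢ²`. -/
theorem exists_quadForm_lower_bound {g : ℕ} {Y : Matrix (Fin g) (Fin g) ℝ} (hY : Y.PosDef) :
    ∃ c : ℝ, 0 < c ∧ ∀ x : Fin g → ℝ, c * ∑ i, x i ^ 2 ≤ x ⬝ᵥ Y *ᵥ x := by
  have hcont : Continuous fun x : Fin g → ℝ => x ⬝ᵥ Y *ᵥ x := by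
    simp only [dotProduct, Matrix.mulVec]
    fun_prop
  obtain ⟨a, ha, hle⟩ := (isCompact_sphere (0 : Fin g → ℝ) 1).exists_forall_le'
    (f := fun x => x ⬝ᵥ Y *ᵥ x) (a := 0) hcont.continuousOn (by
      intro x hx
      have hx0 : x ≠ 0 := by
        rintro rfl
        simp at hx
      simpa using hY.dotProduct_mulVec_pos hx0)
  have key : ∀ x : Fin g → ℝ, a * ‖x‖ ^ 2 ≤ x ⬝ᵥ Y *ᵥ x := by
    intro x
    by_cases hx : x = 0
    · simp [hx]
    have hn : 0 < ‖x‖ := norm_pos_iff.mpr hx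
    have h := hle (‖x‖⁻¹ • x) (by simp [norm_smul, hn.ne'])
    simp only [Matrix.mulVec_smul, dotProduct_smul, smul_dotProduct, smul_eq_mul] at h
    calc a * ‖x‖ ^ 2 ≤ (‖x‖⁻¹ * (‖x‖⁻¹ * (x ⬝ᵥ Y *ᵥ x))) * ‖x‖ ^ 2 := by gcongr
      _ = x ⬝ᵥ Y *ᵥ x := by field_simp
  refine ⟨a / (g + 1), by positivity, fun x => le_trans ?_ (key x)⟩
  have hs : ∑ i, x i ^ 2 ≤ (g + 1) * ‖x‖ ^ 2 := by
    calc ∑ i, x i ^ 2 ≤ ∑ _i : Fin g, ‖x‖ ^ 2 := by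
          refine Finset.sum_le_sum fun i _ => ?_
          have := norm_le_pi_norm x i
          rw [Real.norm_eq_abs] at this
          exact sq_le_sq' (by linarith [neg_abs_le (x i)]) (by linarith [le_abs_self (x i)])
      _ = g * ‖x‖ ^ 2 := by simp
      _ ≤ (g + 1) * ‖x‖ ^ 2 := by nlinarith [sq_nonneg ‖x‖]
  calc a / (g + 1) * ∑ i, x i ^ 2 ≤ a / (g + 1) * ((g + 1) * ‖x‖ ^ 2) := by gcongr
    _ = a * ‖x‖ ^ 2 := by field_simp

theorem summable_prod_apply {g : ℕ} {F : Fin g → ℤ → ℝ} (h0 : ∀ i n, 0 ≤ F i n)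
    (hF : ∀ i, Summable (F i)) : Summable fun n : Fin g → ℤ => ∏ i, F i (n i) := by
  induction g with
  | zero => exact Summable.of_finite
  | succ g ih =>
    rw [← (Fin.consEquiv fun _ => ℤ).summable_iff]
    have := (hF 0).mul_of_nonneg (ih (F := fun i => F i.succ) (fun i => h0 _) fun i => hF _)
      (h0 0) (fun n => Finset.prod_nonneg fun i _ => h0 _ _)
    simpa [Function.comp_def, Fin.prod_univ_succ, Fin.consEquiv] using this

theorem summable_exp_quadratic {c : ℝ} (hc : 0 < c) (e y : ℝ) :
    Summable fun n : ℤ => Real.exp (-Real.pi * (c * (n + e) ^ 2 + 2 * ((n + e) * y))) := by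
  have h := ((summable_jacobiTheta₂_term_iff ((c * e + y : ℝ) * Complex.I)
    (c * Complex.I)).mpr (by simpa using hc)).norm.mul_left
      (Real.exp (-Real.pi * (c * e ^ 2 + 2 * (e * y))))
  refine h.congr fun n => ?_
  rw [norm_jacobiTheta₂_term, ← Real.exp_add]
  congr 1
  simp
  ring

/-- The theta series converges absolutely on `ℍ_g`. -/
theorem summable_thetaTerm {g : ℕ} (ε₁ ε₂ : Fin g → ℤ) (z : Fin g → ℂ)
    {τ : Matrix (Fin g) (Fin g) ℂ} (hτ : τ ∈ upperHalfSpace g) :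
    Summable (thetaTerm ε₁ ε₂ z τ) := by
  obtain ⟨c, hc, hle⟩ := exists_quadForm_lower_bound hτ.2
  refine Summable.of_norm_bounded (summable_prod_apply (F := fun i (n : ℤ) =>
    Real.exp (-Real.pi * (c * (n + (ε₁ i : ℝ) / 2) ^ 2 + 2 * ((n + (ε₁ i : ℝ) / 2) * (z i).im))))
    (fun _ _ => (Real.exp_pos _).le) fun i => summable_exp_quadratic hc _ _) fun n => ?_
  rw [thetaTerm, Complex.norm_exp, ← Real.exp_sum, Real.exp_le_exp]
  set x : Fin g → ℝ := fun i => (n i : ℝ) + (ε₁ i : ℝ) / 2 with hx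
  have hs : ∀ i, shifted ε₁ n i = (x i : ℂ) := by
    intro i
    simp [shifted, hx]
  have h1 : (shifted ε₁ n ⬝ᵥ τ *ᵥ shifted ε₁ n).im = x ⬝ᵥ (τ.map Complex.im) *ᵥ x := by
    simp [dotProduct, Matrix.mulVec, hs, Complex.im_sum]
  have h2 : (shifted ε₁ n ⬝ᵥ fun i => z i + (ε₂ i : ℂ) / 2).im = ∑ i, x i * (z i).im := by
    have h3 : ∀ i, (z i + (ε₂ i : ℂ) / 2).im = (z i).im := by
      intro i
      have : ((ε₂ i : ℂ) / 2) = (((ε₂ i : ℝ) / 2 : ℝ) : ℂ) := by push_cast; rfl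
      rw [this, Complex.add_im, Complex.ofReal_im, add_zero]
    simp only [dotProduct, hs, Complex.im_sum, Complex.im_ofReal_mul, h3]
  have h4 : ∀ w : ℂ, (Real.pi * Complex.I * w).re = -Real.pi * w.im := by
    intro w
    simp
  have h5 : (2 * (shifted ε₁ n ⬝ᵥ fun i => z i + (ε₂ i : ℂ) / 2)).im
      = 2 * ∑ i, x i * (z i).im := by
    rw [← h2]
    simp
  rw [h4, Complex.add_im, h1, h5, ← Finset.mul_sum, Finset.sum_add_distrib, ← Finset.mul_sum,
    ← Finset.mul_sum]
  have := hle x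
  nlinarith [Real.pi_pos, mul_le_mul_of_nonneg_left this Real.pi_pos.le]

/-- The theta function `θ[ε₁, ε₂](z, τ)` with characteristic `[ε₁, ε₂]`; the series converges
absolutely on `ℍ_g`, see `summable_thetaTerm`. -/
def theta {g : ℕ} (ε₁ ε₂ : Fin g → ℤ) (z : Fin g → ℂ) (τ : Matrix (Fin g) (Fin g) ℂ) : ℂ :=
  ∑' n : Fin g → ℤ, thetaTerm ε₁ ε₂ z τ n

/-- The Thetanullwert `θ[ε₁, ε₂](τ) = θ[ε₁, ε₂](0, τ)`. -/
def thetaNull {g : ℕ} (ε₁ ε₂ : Fin g → ℤ) (τ : Matrix (Fin g) (Fin g) ℂ) : ℂ :=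
  theta ε₁ ε₂ 0 τ

/-- The integral vector with entries in `{0, 1}` given by an element of `Fin g → Fin 2`. -/
def lift {g : ℕ} (a : Fin g → Fin 2) : Fin g → ℤ := fun i => ((a i : ℕ) : ℤ)

/-- The set `S_g` of even characteristics with entries in `{0, 1}`. -/
def evenChars (g : ℕ) : Finset ((Fin g → Fin 2) × (Fin g → Fin 2)) :=
  Finset.univ.filter fun ε => Even (lift ε.1 ⬝ᵥ lift ε.2)

/-- The number `k = #S_g / 2`; here `#S_g = 2^{g-1}(2^g + 1)` is even as soon as `g ≥ 2`. -/
def chiWeight (g : ℕ) : ℕ := (evenChars g).card / 2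

/-- `χ_k`, the product of all even Thetanullwerte. -/
def chi (g : ℕ) (τ : Matrix (Fin g) (Fin g) ℂ) : ℂ :=
  ∏ ε ∈ evenChars g, thetaNull (lift ε.1) (lift ε.2) τ

end SiegelTheta

end

/-! Scaling `τ` by `1/2` conjugates `M = [A B; C D]` with `B` even into `N = [A B/2; 2C D]`, again
an integral symplectic matrix, and `C τ + D` is unchanged (`exists_act_half`). It is therefore
enough that `χ_k` itself is modular of weight `k` for the whole of `Sp_{2g}(ℤ)` (`chi_act`).

The matrices satisfying this law form a subgroup, so generators suffice: translations `τ ↦ τ + S`,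
the Levi maps `τ ↦ U τ Uᵀ` and the partial inversions in one coordinate (`mem_of_generators_mem`).
Partial inversions take the place of the full inversion because they need Poisson summation in a
single variable only, that is, Jacobi's functional equation.

Each generator permutes the even Thetanullwerte up to an eighth root of unity and, for an inversion,
a factor `√(-i τ_ii)` (`thetaNull_add_intCast`, `thetaNull_levi`, `thetaNull_partialInversion`). In
the product the square roots give `(-i τ_ii)^k`, since there are `2k` factors, and what remains is
that the roots of unity multiply to `1`. This is a count over `{0,1}^g`, and it is here that `g ≥ 3`
enters: `eight_dvd_sum_quadForm` for translations, `even_sum_evenHalf` and the evenness of `k` for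
Levi maps, `four_dvd_chiWeight_add` for inversions.

Holomorphy comes from termwise differentiation of the theta series with a Gaussian majorant
(`differentiableAt_thetaNull`). -/

noncomputable section

namespace SiegelTheta

open Matrix

variable {g : ℕ}

/-! ### Block relations of integral symplectic matrices -/

section Blocks

theorem fromBlocks_blocks (M : siegelModularGroup g) :
    fromBlocks (blockA M) (blockB M) (blockC M) (blockD M) = M.1 :=
  fromBlocks_toBlocks M.1

/-- The symplectic matrix with given blocks. -/
def ofBlocks (A B C D : Matrix (Fin g) (Fin g) ℤ) (h₁ : A * Bᵀ = B * Aᵀ) (h₂ : C * Dᵀ = D * Cᵀ)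
    (h₃ : A * Dᵀ - B * Cᵀ = 1) : siegelModularGroup g :=
  ⟨fromBlocks A B C D, by
    have h₄ : D * Aᵀ - C * Bᵀ = 1 := by
      simpa [transpose_sub, transpose_mul] using congrArg transpose h₃
    rw [SymplecticGroup.mem_iff]
    simp only [J, fromBlocks_multiply, fromBlocks_transpose, mul_zero, zero_add, mul_one, mul_neg,
      add_zero, neg_mul]
    rw [h₁, h₂, ← sub_eq_add_neg (D * _), h₄,
      add_neg_cancel, add_neg_cancel, ← sub_eq_add_neg, ← neg_sub, h₃]⟩

section ofBlocks

variable {A B C D : Matrix (Fin g) (Fin g) ℤ} {h₁ : A * Bᵀ = B * Aᵀ} {h₂ : C * Dᵀ = D * Cᵀ}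
    {h₃ : A * Dᵀ - B * Cᵀ = 1}

@[simp] theorem blockA_ofBlocks : blockA (ofBlocks A B C D h₁ h₂ h₃) = A := rfl
@[simp] theorem blockB_ofBlocks : blockB (ofBlocks A B C D h₁ h₂ h₃) = B := rfl
@[simp] theorem blockC_ofBlocks : blockC (ofBlocks A B C D h₁ h₂ h₃) = C := rfl
@[simp] theorem blockD_ofBlocks : blockD (ofBlocks A B C D h₁ h₂ h₃) = D := rfl

end ofBlocks

theorem ext_blocks {M N : siegelModularGroup g} (hA : blockA M = blockA N)
    (hB : blockB M = blockB N) (hC : blockC M = blockC N) (hD : blockD M = blockD N) : M = N := by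
  apply Subtype.ext
  rw [← fromBlocks_blocks M, ← fromBlocks_blocks N, hA, hB, hC, hD]

theorem coe_mul_eq_fromBlocks (M N : siegelModularGroup g) : (M * N).1 =
    fromBlocks (blockA M * blockA N + blockB M * blockC N)
      (blockA M * blockB N + blockB M * blockD N)
      (blockC M * blockA N + blockD M * blockC N)
      (blockC M * blockB N + blockD M * blockD N) := by
  rw [← fromBlocks_multiply, fromBlocks_blocks, fromBlocks_blocks]
  rfl

theorem blockA_mul (M N : siegelModularGroup g) :
    blockA (M * N) = blockA M * blockA N + blockB M * blockC N :=
  congrArg toBlocks₁₁ (coe_mul_eq_fromBlocks M N)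

theorem blockB_mul (M N : siegelModularGroup g) :
    blockB (M * N) = blockA M * blockB N + blockB M * blockD N :=
  congrArg toBlocks₁₂ (coe_mul_eq_fromBlocks M N)

theorem blockC_mul (M N : siegelModularGroup g) :
    blockC (M * N) = blockC M * blockA N + blockD M * blockC N :=
  congrArg toBlocks₂₁ (coe_mul_eq_fromBlocks M N)

theorem blockD_mul (M N : siegelModularGroup g) :
    blockD (M * N) = blockC M * blockB N + blockD M * blockD N :=
  congrArg toBlocks₂₂ (coe_mul_eq_fromBlocks M N)

theorem blocks_row_relations (M : siegelModularGroup g) :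
    blockA M * (blockB M)ᵀ = blockB M * (blockA M)ᵀ ∧
    blockC M * (blockD M)ᵀ = blockD M * (blockC M)ᵀ ∧
    blockA M * (blockD M)ᵀ - blockB M * (blockC M)ᵀ = 1 := by
  have h := SymplecticGroup.mem_iff.mp M.2
  rw [← fromBlocks_blocks M] at h
  simp only [J, fromBlocks_multiply, fromBlocks_transpose, mul_zero, zero_add, mul_one, mul_neg,
      add_zero, neg_mul, fromBlocks_inj] at h
  obtain ⟨h1, h2, -, h4⟩ := h
  refine ⟨(add_neg_eq_zero.mp h1).symm, (add_neg_eq_zero.mp h4).symm, ?_⟩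
  rw [← neg_inj, ← h2]
  abel

theorem blocks_column_relations (M : siegelModularGroup g) :
    (blockA M)ᵀ * blockC M = (blockC M)ᵀ * blockA M ∧
    (blockB M)ᵀ * blockD M = (blockD M)ᵀ * blockB M ∧
    (blockA M)ᵀ * blockD M - (blockC M)ᵀ * blockB M = 1 := by
  have h := SymplecticGroup.mem_iff'.mp M.2
  rw [← fromBlocks_blocks M] at h
  simp only [J, fromBlocks_multiply, fromBlocks_transpose, mul_zero, zero_add, mul_one, mul_neg,
      add_zero, neg_mul, fromBlocks_inj] at h
  obtain ⟨h1, h2, -, h4⟩ := h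
  refine ⟨(add_neg_eq_zero.mp h1).symm, (add_neg_eq_zero.mp h4).symm, ?_⟩
  rw [← neg_inj, ← h2]
  abel

end Blocks

/-! ### The action on the Siegel upper half space -/

section Action

variable (M N : siegelModularGroup g) (τ : Matrix (Fin g) (Fin g) ℂ)

theorem num_mul (h : IsUnit (denom N τ).det) :
    num (M * N) τ = num M (act N τ) * denom N τ := by
  have h' : act N τ * denom N τ = num N τ := by
    rw [act, Matrix.mul_assoc, nonsing_inv_mul _ h, Matrix.mul_one]
  have e : num M (act N τ) = (blockA M).map Int.cast * act N τ + (blockB M).map Int.cast := rfl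
  rw [e, add_mul, Matrix.mul_assoc, h', num, num, denom, blockA_mul, blockB_mul]
  simp only [Matrix.map_add _ Int.cast_add, Matrix.map_mul_intCast]
  noncomm_ring

theorem denom_mul (h : IsUnit (denom N τ).det) :
    denom (M * N) τ = denom M (act N τ) * denom N τ := by
  have h' : act N τ * denom N τ = num N τ := by
    rw [act, Matrix.mul_assoc, nonsing_inv_mul _ h, Matrix.mul_one]
  have e : denom M (act N τ) = (blockC M).map Int.cast * act N τ + (blockD M).map Int.cast := rfl
  rw [e, add_mul, Matrix.mul_assoc, h', num, denom, denom, blockC_mul, blockD_mul]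
  simp only [Matrix.map_add _ Int.cast_add, Matrix.map_mul_intCast]
  noncomm_ring

theorem autFactor_mul (h : IsUnit (denom N τ).det) :
    autFactor (M * N) τ = autFactor M (act N τ) * autFactor N τ := by
  rw [autFactor, denom_mul M N τ h, det_mul, autFactor, autFactor]

theorem act_mul (h : IsUnit (denom N τ).det) : act (M * N) τ = act M (act N τ) := by
  rw [act, num_mul M N τ h, denom_mul M N τ h, Matrix.mul_inv_rev, Matrix.mul_assoc,
    ← Matrix.mul_assoc (denom N τ), mul_nonsing_inv _ h, Matrix.one_mul]
  rfl

theorem blocks_column_relations_complex :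
    ((blockA M).map (Int.cast : ℤ → ℂ))ᵀ * (blockC M).map Int.cast
      = ((blockC M).map Int.cast)ᵀ * (blockA M).map Int.cast ∧
    ((blockB M).map (Int.cast : ℤ → ℂ))ᵀ * (blockD M).map Int.cast
      = ((blockD M).map Int.cast)ᵀ * (blockB M).map Int.cast ∧
    ((blockA M).map (Int.cast : ℤ → ℂ))ᵀ * (blockD M).map Int.cast
      = 1 + ((blockC M).map Int.cast)ᵀ * (blockB M).map Int.cast := by
  obtain ⟨h1, h2, h3⟩ := blocks_column_relations M
  rw [sub_eq_iff_eq_add] at h3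
  refine ⟨?_, ?_, ?_⟩
  · simpa only [Matrix.map_mul_intCast, transpose_map] using
      congrArg (fun X => X.map (Int.cast : ℤ → ℂ)) h1
  · simpa only [Matrix.map_mul_intCast, transpose_map] using
      congrArg (fun X => X.map (Int.cast : ℤ → ℂ)) h2
  · simpa [Matrix.map_mul_intCast, transpose_map, Matrix.map_add] using
      congrArg (fun X => X.map (Int.cast : ℤ → ℂ)) h3

/-- The invariance of the symplectic form, polarized in two points. Taking `σ = τ` gives the
symmetry of `M.τ`; taking `σ` to be the complex conjugate of `τ` gives the invertibility of `C τ +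
D` and the positivity of `Im M.τ`. -/
theorem num_denom_relation (σ : Matrix (Fin g) (Fin g) ℂ) :
    (num M σ)ᵀ * denom M τ - (denom M σ)ᵀ * num M τ = σᵀ - τ := by
  obtain ⟨h1, h2, h3⟩ := blocks_column_relations_complex M
  have h4 := congrArg transpose h3
  simp only [transpose_mul, transpose_add, transpose_transpose, transpose_one] at h4
  set A := (blockA M).map (Int.cast : ℤ → ℂ)
  set B := (blockB M).map (Int.cast : ℤ → ℂ)
  set C := (blockC M).map (Int.cast : ℤ → ℂ)
  set D := (blockD M).map (Int.cast : ℤ → ℂ)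
  have e : (num M σ)ᵀ * denom M τ - (denom M σ)ᵀ * num M τ
      = σᵀ * (Aᵀ * C - Cᵀ * A) * τ + σᵀ * (Aᵀ * D - Cᵀ * B) - (Dᵀ * A - Bᵀ * C) * τ
        + (Bᵀ * D - Dᵀ * B) := by
    simp only [num, denom, transpose_add, transpose_mul]
    noncomm_ring
  rw [e, h1, h2, h3, h4]
  simp

theorem star_intCast_map (A : Matrix (Fin g) (Fin g) ℤ) :
    (A.map (Int.cast : ℤ → ℂ))ᴴ = (A.map (Int.cast : ℤ → ℂ))ᵀ := by
  ext i j
  simp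

theorem im_star_denom_dotProduct_num (x : Fin g → ℂ) :
    (star (denom M τ *ᵥ x) ⬝ᵥ num M τ *ᵥ x).im = (star x ⬝ᵥ τ *ᵥ x).im := by
  have hP : (num M (τ.map star))ᵀ = (num M τ)ᴴ := by
    simp only [num, transpose_add, transpose_mul, conjTranspose_add, conjTranspose_mul,
      star_intCast_map]
    rfl
  have hQ : (denom M (τ.map star))ᵀ = (denom M τ)ᴴ := by
    simp only [denom, transpose_add, transpose_mul, conjTranspose_add, conjTranspose_mul,
      star_intCast_map]
    rfl
  have h : _ = τᴴ - τ := num_denom_relation M τ (τ.map star)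
  rw [hP, hQ] at h
  have h' := congrArg (fun X => star x ⬝ᵥ X *ᵥ x) h
  have hs : ∀ z w : ℂ, star z - z = star w - w → z.im = w.im := by
    intro z w hzw
    have := congrArg Complex.im hzw
    simp at this
    linarith
  apply hs
  rw [← star_dotProduct, ← star_dotProduct]
  have e : star (τ *ᵥ x) ⬝ᵥ x = star x ⬝ᵥ τᴴ *ᵥ x := by
    rw [star_mulVec, dotProduct_mulVec]
  rw [e]
  simpa only [sub_mulVec, dotProduct_sub, ← mulVec_mulVec, dotProduct_mulVec (star x) (_ᴴ) (_ *ᵥ _),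
    ← star_mulVec] using h'

/-- The contributions of `Re τ` are antisymmetric in the two indices and cancel because `τ` is
symmetric. -/
theorem im_star_dotProduct_mulVec {τ : Matrix (Fin g) (Fin g) ℂ} (hτ : τ.IsSymm)
    (x : Fin g → ℂ) : (star x ⬝ᵥ τ *ᵥ x).im =
      (fun i => (x i).re) ⬝ᵥ τ.map Complex.im *ᵥ (fun i => (x i).re) +
      (fun i => (x i).im) ⬝ᵥ τ.map Complex.im *ᵥ (fun i => (x i).im) := by
  have h : ∑ i, ∑ j, (τ i j).re * ((x i).re * (x j).im - (x i).im * (x j).re) = 0 := by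
    have h' : ∑ i, ∑ j, (τ i j).re * ((x i).re * (x j).im - (x i).im * (x j).re) =
        - ∑ i, ∑ j, (τ i j).re * ((x i).re * (x j).im - (x i).im * (x j).re) := by
      conv_lhs => rw [Finset.sum_comm]
      simp only [← Finset.sum_neg_distrib]
      refine Finset.sum_congr rfl fun i _ => Finset.sum_congr rfl fun j _ => ?_
      rw [hτ.apply i j]
      ring
    linarith
  simp only [dotProduct, mulVec, Complex.im_sum, Finset.mul_sum, ← Finset.sum_add_distrib]
  rw [← sub_eq_zero, ← h, ← Finset.sum_sub_distrib]
  refine Finset.sum_congr rfl fun i _ => ?_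
  rw [← Finset.sum_sub_distrib]
  refine Finset.sum_congr rfl fun j _ => ?_
  simp
  ring

theorem im_star_dotProduct_mulVec_pos {τ : Matrix (Fin g) (Fin g) ℂ} (hτ : τ ∈ upperHalfSpace g)
    {x : Fin g → ℂ} (hx : x ≠ 0) : 0 < (star x ⬝ᵥ τ *ᵥ x).im := by
  rw [im_star_dotProduct_mulVec hτ.1]
  have hnn : ∀ y : Fin g → ℝ, 0 ≤ y ⬝ᵥ τ.map Complex.im *ᵥ y := fun y => by
    simpa using hτ.2.posSemidef.dotProduct_mulVec_nonneg y
  have hpos : ∀ y : Fin g → ℝ, y ≠ 0 → 0 < y ⬝ᵥ τ.map Complex.im *ᵥ y := fun y hy => by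
    simpa using hτ.2.dotProduct_mulVec_pos hy
  by_cases h : (fun i => (x i).re) = 0
  · refine add_pos_of_nonneg_of_pos (hnn _) (hpos _ fun h' => hx ?_)
    ext i
    exact Complex.ext (congrFun h i) (congrFun h' i)
  · exact add_pos_of_pos_of_nonneg (hpos _ h) (hnn _)

variable {τ}

/-- A nonzero kernel vector of `C τ + D` would make the invariant form `Im (x* τ x)` vanish, against
positivity. -/
theorem isUnit_det_denom (hτ : τ ∈ upperHalfSpace g) : IsUnit (denom M τ).det := by
  rw [isUnit_iff_ne_zero]
  intro h
  obtain ⟨x, hx, hx0⟩ := exists_mulVec_eq_zero_iff.mpr h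
  have := im_star_dotProduct_mulVec_pos hτ hx
  rw [← im_star_denom_dotProduct_num M τ, hx0] at this
  simp at this

theorem act_mul_denom (hτ : τ ∈ upperHalfSpace g) : act M τ * denom M τ = num M τ := by
  rw [act, Matrix.mul_assoc, nonsing_inv_mul _ (isUnit_det_denom M hτ), Matrix.mul_one]

theorem act_mem (hτ : τ ∈ upperHalfSpace g) : act M τ ∈ upperHalfSpace g := by
  have hu := isUnit_det_denom M hτ
  have hsymm : (act M τ).IsSymm := by
    have h := num_denom_relation M τ τ
    rw [hτ.1.eq, sub_self, sub_eq_zero] at h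
    have h2 : (act M τ)ᵀ * denom M τ = num M τ := by
      rw [act, transpose_mul, transpose_nonsing_inv, Matrix.mul_assoc, h, ← Matrix.mul_assoc,
        nonsing_inv_mul _ (by rwa [det_transpose]), Matrix.one_mul]
    rw [IsSymm, ← Matrix.mul_one (act M τ)ᵀ, ← mul_nonsing_inv _ hu, ← Matrix.mul_assoc, h2, act]
  refine ⟨hsymm, PosDef.of_dotProduct_mulVec_pos ?_ fun v hv => ?_⟩
  · ext i j
    simp [hsymm.apply i j]
  -- With `(C τ + D) x = v`, the invariance of the form turns `Im (vᵀ (M.τ) v)` into `Im (x* τ x)`,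
  -- which is positive.
  set x : Fin g → ℂ := (denom M τ)⁻¹ *ᵥ fun i => (v i : ℂ)
  have hQ : denom M τ *ᵥ x = fun i => (v i : ℂ) := by
    rw [mulVec_mulVec, mul_nonsing_inv _ hu, one_mulVec]
  have hP : num M τ *ᵥ x = act M τ *ᵥ fun i => (v i : ℂ) := by
    rw [← act_mul_denom M hτ, ← mulVec_mulVec, hQ]
  have hx : x ≠ 0 := by
    intro h
    rw [h, mulVec_zero] at hQ
    exact hv (funext fun i => by simpa using (congrFun hQ i).symm)
  have := im_star_dotProduct_mulVec_pos hτ hx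
  rw [← im_star_denom_dotProduct_num M τ, hQ, hP, im_star_dotProduct_mulVec hsymm] at this
  simpa [← Pi.zero_def] using this

end Action

/-! ### Generators of the integral symplectic group -/

/-- The symplectic matrix `[1 S; 0 1]`, which acts on `ℍ_g` by `τ ↦ τ + S`. -/
def translation (S : Matrix (Fin g) (Fin g) ℤ) (hS : S.IsSymm) : siegelModularGroup g :=
  ofBlocks 1 S 0 1 (by simp [hS.eq]) (by simp) (by simp)

/-- The symplectic matrix `[U 0; 0 U⁻ᵀ]`, which acts on `ℍ_g` by `τ ↦ U τ Uᵀ`. -/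
def levi (U : (Matrix (Fin g) (Fin g) ℤ)ˣ) : siegelModularGroup g :=
  ofBlocks U.1 0 0 (U⁻¹).1ᵀ (by simp) (by simp) (by simp)

/-- The inversion in the `i`-th coordinate. -/
def partialInversion (i : Fin g) : siegelModularGroup g :=
  ofBlocks (1 - diagonal (Pi.single i 1)) (-diagonal (Pi.single i 1)) (diagonal (Pi.single i 1))
    (1 - diagonal (Pi.single i 1)) (by simp [sub_mul, mul_sub]) (by simp [sub_mul, mul_sub]) (by
      have h : (diagonal (Pi.single i 1) : Matrix (Fin g) (Fin g) ℤ) * diagonal (Pi.single i 1)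
          = diagonal (Pi.single i 1) := by
        rw [diagonal_mul_diagonal]
        congr 1
        ext j
        by_cases hj : j = i <;> simp [hj]
      simp only [transpose_sub, transpose_one, diagonal_transpose, sub_mul, mul_sub, one_mul,
        mul_one, neg_mul, h]
      abel)

/-- The Euclidean algorithm for the pair `(x, y)`: `hadd` replaces `x` by its remainder modulo `y`,
`hswap` moves that remainder into `y` up to sign, and `|y|` drops. The relation `rel` carries
whatever the allowed moves preserve. -/
theorem exists_euclidean_reduction {α : Type*} {rel : α → α → Prop} (hrefl : ∀ s, rel s s)
    (htrans : ∀ s t u, rel s t → rel t u → rel s u) (x y : α → ℤ)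
    (hadd : ∀ s n, ∃ t, rel s t ∧ x t = x s + n * y s ∧ y t = y s)
    (hswap : ∀ s, ∃ t, rel s t ∧ (y t).natAbs = (x s).natAbs) (s : α) :
    ∃ t, rel s t ∧ y t = 0 := by
  induction h : (y s).natAbs using Nat.strong_induction_on generalizing s with
  | _ m ih =>
    by_cases hy : y s = 0
    · exact ⟨s, hrefl s, hy⟩
    obtain ⟨t, hst, hxt, hyt⟩ := hadd s (-(x s / y s))
    obtain ⟨u, htu, hyu⟩ := hswap t
    have hmod : x t = x s % y s := by
      rw [hxt, Int.emod_def]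
      ring
    have hlt : (y u).natAbs < m := by
      rw [← h, hyu, hmod]
      have h1 := Int.emod_nonneg (x s) hy
      have h2 := Int.emod_lt_abs (x s) hy
      rw [Int.abs_eq_natAbs] at h2
      omega
    obtain ⟨v, huv, hv⟩ := ih _ hlt u rfl
    exact ⟨v, htrans _ _ _ hst (htrans _ _ _ htu huv), hv⟩

section Generation

variable {K : Subgroup (siegelModularGroup g)}

/-- Euclid on `(D r i, C r i)`: right multiplication by a translation supported at `(i, i)` adds a
multiple of column `i` of `C` to column `i` of `D`, and the partial inversion exchanges these two
columns up to sign. Other columns do not move, and a row with zeros in both places keeps them. -/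
theorem exists_blockC_apply_eq_zero (hT : ∀ S hS, translation S hS ∈ K)
    (hI : ∀ i, partialInversion i ∈ K) (r i : Fin g) (M : siegelModularGroup g) :
    ∃ N, (M⁻¹ * N ∈ K ∧
      (∀ b j, j ≠ i → blockC N b j = blockC M b j ∧ blockD N b j = blockD M b j) ∧
      (∀ b, blockC M b i = 0 → blockD M b i = 0 → blockC N b i = 0 ∧ blockD N b i = 0)) ∧
      blockC N r i = 0 := by
  refine exists_euclidean_reduction (rel := fun M N => M⁻¹ * N ∈ K ∧
      (∀ b j, j ≠ i → blockC N b j = blockC M b j ∧ blockD N b j = blockD M b j) ∧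
      (∀ b, blockC M b i = 0 → blockD M b i = 0 → blockC N b i = 0 ∧ blockD N b i = 0))
    (fun s => ⟨by simp, fun b j _ => ⟨rfl, rfl⟩, fun b h h' => ⟨h, h'⟩⟩) ?_
    (fun s => blockD s r i) (fun s => blockC s r i) ?_ ?_ M
  · rintro s t u ⟨h1, h2, h3⟩ ⟨h1', h2', h3'⟩
    refine ⟨by simpa [mul_assoc] using mul_mem h1 h1', fun b j hj => ?_, fun b hc hd => ?_⟩
    · rw [(h2' b j hj).1, (h2' b j hj).2]
      exact h2 b j hj
    · exact h3' b (h3 b hc hd).1 (h3 b hc hd).2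
  · intro s n
    have e1 : blockC (s * translation (diagonal (Pi.single i n)) (isSymm_diagonal _))
        = blockC s := by
      simp [blockC_mul, translation]
    have e2 : ∀ b j, blockD (s * translation (diagonal (Pi.single i n)) (isSymm_diagonal _)) b j
        = blockD s b j + (Pi.single i n : Fin g → ℤ) j * blockC s b j := by
      intro b j
      simp [blockD_mul, translation, mul_comm, add_comm]
    refine ⟨s * translation (diagonal (Pi.single i n)) (isSymm_diagonal _),
      ⟨by simpa using hT _ _, fun b j hj => ?_, fun b hc hd => ?_⟩, ?_, ?_⟩
    · simp [e1, e2, hj]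
    · simp [e1, e2, hc, hd]
    · simp [e2]
    · simp only [e1]
  · intro s
    have e1 : ∀ b j, blockC (s * partialInversion i) b j = blockC s b j
        + (blockD s b j - blockC s b j) * (Pi.single i 1 : Fin g → ℤ) j := by
      intro b j
      simp [blockC_mul, partialInversion, mul_sub]
      ring
    have e2 : ∀ b j, blockD (s * partialInversion i) b j = blockD s b j
        - (blockC s b j + blockD s b j) * (Pi.single i 1 : Fin g → ℤ) j := by
      intro b j
      simp [blockD_mul, partialInversion, mul_sub]
      ring
    refine ⟨s * partialInversion i,
      ⟨by simpa using hI i, fun b j hj => ?_, fun b hc hd => ?_⟩, ?_⟩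
    · simp [e1, e2, hj]
    · simp [e1, e2, hc, hd]
    · simp [e1]

theorem blockC_mul_levi (M : siegelModularGroup g) (U : (Matrix (Fin g) (Fin g) ℤ)ˣ) :
    blockC (M * levi U) = blockC M * U := by
  simp [blockC_mul, levi]

theorem blockD_mul_levi (M : siegelModularGroup g) (U : (Matrix (Fin g) (Fin g) ℤ)ˣ) :
    blockD (M * levi U) = blockD M * (U⁻¹).1ᵀ := by
  simp [blockD_mul, levi]

/-- An elementary matrix as a unit. -/
def transvectionUnit (i j : Fin g) (h : i ≠ j) (n : ℤ) : (Matrix (Fin g) (Fin g) ℤ)ˣ where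
  val := transvection i j n
  inv := transvection i j (-n)
  val_inv := by rw [transvection_mul_transvection_same _ _ h, add_neg_cancel, transvection_zero]
  inv_val := by rw [transvection_mul_transvection_same _ _ h, neg_add_cancel, transvection_zero]

theorem blockD_mul_levi_transvectionUnit (M : siegelModularGroup g) {i j : Fin g} (h : i ≠ j)
    (n : ℤ) (b l : Fin g) : blockD (M * levi (transvectionUnit i j h n)) b l
      = blockD M b l - (Pi.single i n : Fin g → ℤ) l * blockD M b j := by
  rw [blockD_mul_levi]
  change (blockD M * (transvection i j (-n))ᵀ) b l = _
  by_cases hl : l = i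
  · subst hl
    simp [transvection, mul_add, transpose_add, transpose_single]
    ring
  · simp [transvection, mul_add, transpose_add, transpose_single, hl]

/-- Euclid on two entries of a row of `D`, by transvections acting on the columns `i` and `j`. Zero
rows of `C` stay zero, since Levi elements only combine columns of `C` among themselves. -/
theorem exists_blockD_apply_eq_zero (hU : ∀ U, levi U ∈ K) (r : Fin g) {i j : Fin g} (hij : i ≠ j)
    (M : siegelModularGroup g) :
    ∃ N, (M⁻¹ * N ∈ K ∧ (∀ b, (∀ l, blockC M b l = 0) → ∀ l, blockC N b l = 0) ∧
      (∀ b l, l ≠ i → l ≠ j → blockD N b l = blockD M b l) ∧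
      (∀ b, blockD M b i = 0 → blockD M b j = 0 → blockD N b i = 0 ∧ blockD N b j = 0)) ∧
      blockD N r j = 0 := by
  have hC : ∀ (M : siegelModularGroup g) U b, (∀ l, blockC M b l = 0) →
      ∀ l, blockC (M * levi U) b l = 0 := by
    intro M U b h l
    rw [blockC_mul_levi, mul_apply]
    simp [h]
  refine exists_euclidean_reduction (rel := fun M N => M⁻¹ * N ∈ K ∧
      (∀ b, (∀ l, blockC M b l = 0) → ∀ l, blockC N b l = 0) ∧
      (∀ b l, l ≠ i → l ≠ j → blockD N b l = blockD M b l) ∧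
      (∀ b, blockD M b i = 0 → blockD M b j = 0 → blockD N b i = 0 ∧ blockD N b j = 0))
    (fun s => ⟨by simp, fun _ h => h, fun _ _ _ _ => rfl, fun b h h' => ⟨h, h'⟩⟩) ?_
    (fun s => blockD s r i) (fun s => blockD s r j) ?_ ?_ M
  · rintro s t u ⟨h1, h2, h3, h4⟩ ⟨h1', h2', h3', h4'⟩
    refine ⟨by simpa [mul_assoc] using mul_mem h1 h1', fun b h => h2' b (h2 b h),
      fun b l hi hj => (h3' b l hi hj).trans (h3 b l hi hj),
      fun b hi hj => h4' b (h4 b hi hj).1 (h4 b hi hj).2⟩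
  · intro s n
    refine ⟨s * levi (transvectionUnit i j hij (-n)), ⟨by simpa using hU _, fun b => hC _ _ _,
      fun b l hi hj => ?_, fun b hi hj => ?_⟩, ?_, ?_⟩ <;>
    simp_all [blockD_mul_levi_transvectionUnit, hij.symm]
  · intro s
    -- The columns `(d_i, d_j)` become `(d_i + d_j, d_j)` and then `(d_i + d_j, -d_i)`, which is
    -- enough of a swap.
    refine ⟨s * levi (transvectionUnit i j hij (-1)) * levi (transvectionUnit j i hij.symm 1),
      ⟨by simpa [mul_assoc] using mul_mem (hU _) (hU _), fun b h => hC _ _ _ (hC _ _ _ h),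
        fun b l hi hj => ?_, fun b hi hj => ?_⟩, ?_⟩ <;>
    simp_all [blockD_mul_levi_transvectionUnit, hij.symm]

theorem eq_zero_of_lower_triangular {D : Matrix (Fin g) (Fin g) ℤ} {r : ℕ}
    (hD : ∀ a : Fin g, (a : ℕ) < r → D a a ≠ 0 ∧ ∀ j, a < j → D a j = 0) {v : Fin g → ℤ}
    (hv : ∀ a : Fin g, (a : ℕ) < r → ∑ l, v l * D a l = 0) (a : Fin g) (ha : (a : ℕ) < r) :
    v a = 0 := by
  induction a using WellFoundedLT.induction with
  | _ a ih =>
    have h := hv a ha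
    rw [Finset.sum_eq_single a] at h
    · exact (mul_eq_zero.mp h).resolve_right (hD a ha).1
    · intro l _ hl
      rcases lt_or_gt_of_ne hl with hl | hl
      · rw [ih l hl (lt_trans hl ha), zero_mul]
      · rw [(hD a ha).2 l hl, mul_zero]
    · simp

/-- The first `r` rows of `(C, D)` are reduced: those of `C` vanish and those of `D` are lower
triangular. -/
def RowsReduced (r : ℕ) (M : siegelModularGroup g) : Prop :=
  ∀ a : Fin g, (a : ℕ) < r → (∀ j, blockC M a j = 0) ∧ ∀ j, a < j → blockD M a j = 0

/-- For a reduced row `b`, the relation `A Dᵀ - B Cᵀ = 1` says that row `a` of `A` pairs with row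
`b` of `D` to `δ_ab`. Triangularity kills the entries of row `a` of `A` before position `a`, which
leaves `A a a * D a a = 1`. -/
theorem RowsReduced.blockD_diag_ne_zero {r : ℕ} {M : siegelModularGroup g} (h : RowsReduced r M)
    (a : Fin g) (ha : (a : ℕ) < r) : blockD M a a ≠ 0 := by
  induction a using WellFoundedLT.induction with
  | _ a ih =>
    have hrel : ∀ b : Fin g, (b : ℕ) < r →
        ∑ l, blockA M a l * blockD M b l = (1 : Matrix (Fin g) (Fin g) ℤ) a b := by
      intro b hb
      rw [← (blocks_row_relations M).2.2]
      simp [mul_apply, (h b hb).1]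
    have h0 := eq_zero_of_lower_triangular (D := blockD M) (r := a) (v := blockA M a)
      (fun b hb => ⟨ih b hb (lt_trans hb ha), (h b (lt_trans hb ha)).2⟩)
      (fun b hb => by rw [hrel b (lt_trans hb ha), one_apply_ne (Fin.ne_of_gt (Fin.lt_def.mpr hb))])
    have h1 := hrel a ha
    rw [Finset.sum_eq_single a, one_apply_eq] at h1
    · intro h2
      simp [h2] at h1
    · intro l _ hl
      rcases lt_or_gt_of_ne hl with hl | hl
      · rw [h0 l hl, zero_mul]
      · rw [(h a ha).2 l hl, mul_zero]
    · simp

/-- By the symmetry of `C Dᵀ`, row `r` of `C` is orthogonal to the first `r` rows of `D`, and these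
are triangular with nonzero diagonal. -/
theorem RowsReduced.blockC_eq_zero {r : Fin g} {M : siegelModularGroup g} (h : RowsReduced r M)
    (j : Fin g) (hj : j < r) : blockC M r j = 0 := by
  refine eq_zero_of_lower_triangular (D := blockD M) (r := r) (v := blockC M r)
    (fun b hb => ⟨h.blockD_diag_ne_zero b hb, (h b hb).2⟩) (fun b hb => ?_) j hj
  have := congrFun (congrFun (blocks_row_relations M).2.1 r) b
  simpa [mul_apply, (h b hb).1] using this

/-- Row `r` of `C` is cleared column by column, then row `r` of `D` to the right of the diagonal.
The columns touched are zero in all earlier rows, so the reduction already achieved survives. -/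
theorem RowsReduced.exists_succ (hT : ∀ S hS, translation S hS ∈ K)
    (hU : ∀ U, levi U ∈ K) (hI : ∀ i, partialInversion i ∈ K) (r : Fin g)
    {M : siegelModularGroup g} (hM : RowsReduced r M) :
    ∃ N, M⁻¹ * N ∈ K ∧ RowsReduced (r + 1) N := by
  have h1 : ∀ m ≤ g, ∃ N, M⁻¹ * N ∈ K ∧ RowsReduced r N ∧
      ∀ j : Fin g, (j : ℕ) < m → blockC N r j = 0 := by
    intro m
    induction m with
    | zero => exact fun _ => ⟨M, by simp, hM, by simp⟩
    | succ m ih =>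
      intro hm
      obtain ⟨N, hN, hr, hN0⟩ := ih (by omega)
      rcases lt_or_ge m r with hmr | hmr
      -- Columns before `r` must not be touched, as earlier rows of `D` are nonzero there; the
      -- symplectic relations already force the entries of `C` to vanish.
      · exact ⟨N, hN, hr, fun j hj => hr.blockC_eq_zero j (Fin.lt_def.mpr (by omega))⟩
      obtain ⟨N', ⟨h1, h2, h3⟩, h4⟩ := exists_blockC_apply_eq_zero hT hI r ⟨m, hm⟩ N
      refine ⟨N', by simpa [mul_assoc] using mul_mem hN h1, fun a ha => ?_, fun j hj => ?_⟩
      · have ham : a < (⟨m, hm⟩ : Fin g) := Fin.lt_def.mpr (by simp; omega)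
        have h5 := h3 a ((hr a ha).1 _) ((hr a ha).2 _ ham)
        refine ⟨fun j => ?_, fun j haj => ?_⟩ <;> rcases eq_or_ne j ⟨m, hm⟩ with rfl | hj
        · exact h5.1
        · rw [(h2 a j hj).1, (hr a ha).1]
        · exact h5.2
        · rw [(h2 a j hj).2, (hr a ha).2 j haj]
      · rcases eq_or_ne j ⟨m, hm⟩ with rfl | hj'
        · exact h4
        · rw [(h2 r j hj').1, hN0]
          have : (j : ℕ) ≠ m := fun h => hj' (Fin.ext h)
          omega
  have h2 : ∀ m ≤ g, ∃ N, M⁻¹ * N ∈ K ∧ RowsReduced r N ∧ (∀ j, blockC N r j = 0) ∧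
      ∀ j : Fin g, r < j → (j : ℕ) < m → blockD N r j = 0 := by
    intro m
    induction m with
    | zero =>
      obtain ⟨N, hN, hr, hN0⟩ := h1 g le_rfl
      exact fun _ => ⟨N, hN, hr, fun j => hN0 j j.2, by simp⟩
    | succ m ih =>
      intro hm
      obtain ⟨N, hN, hr, hC, hD⟩ := ih (by omega)
      rcases le_or_gt m r with hmr | hmr
      · refine ⟨N, hN, hr, hC, fun j hj hjm => ?_⟩
        rw [Fin.lt_def] at hj
        omega
      have hne : r ≠ (⟨m, hm⟩ : Fin g) := fun h => by simp [h] at hmr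
      obtain ⟨N', ⟨h1, h2, h3, h4⟩, h5⟩ := exists_blockD_apply_eq_zero hU r hne N
      refine ⟨N', by simpa [mul_assoc] using mul_mem hN h1,
        fun a ha => ⟨h2 a (hr a ha).1, fun j haj => ?_⟩, h2 r hC, fun j hj hjm => ?_⟩
      · have h6 := h4 a ((hr a ha).2 r ha) ((hr a ha).2 _ (Fin.lt_def.mpr (by simp; omega)))
        by_cases hjr : j = r
        · rw [hjr, h6.1]
        by_cases hjm : j = ⟨m, hm⟩
        · rw [hjm, h6.2]
        rw [h3 a j hjr hjm, (hr a ha).2 j haj]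
      · by_cases hjm' : j = ⟨m, hm⟩
        · rw [hjm', h5]
        · rw [h3 r j hj.ne' hjm', hD j hj]
          have : (j : ℕ) ≠ m := fun h => hjm' (Fin.ext h)
          omega
  obtain ⟨N, hN, hr, hC, hD⟩ := h2 g le_rfl
  refine ⟨N, hN, fun a ha => ?_⟩
  rcases eq_or_ne a r with rfl | har
  · exact ⟨hC, fun j hj => hD j hj j.2⟩
  · refine hr a ?_
    have : (a : ℕ) ≠ r := fun h => har (Fin.ext h)
    omega

theorem mem_of_blockC_eq_zero (hT : ∀ S hS, translation S hS ∈ K) (hU : ∀ U, levi U ∈ K)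
    {M : siegelModularGroup g} (hM : blockC M = 0) : M ∈ K := by
  obtain ⟨h1, -, h3⟩ := blocks_row_relations M
  rw [hM, transpose_zero, mul_zero, sub_zero] at h3
  have h4 : (blockD M)ᵀ * blockA M = 1 := mul_eq_one_comm.mp h3
  have hS : (blockB M * (blockA M)ᵀ).IsSymm := by
    rw [IsSymm, transpose_mul, transpose_transpose, h1]
  let U : (Matrix (Fin g) (Fin g) ℤ)ˣ := ⟨blockA M, (blockD M)ᵀ, h3, h4⟩
  have h5 : (blockA M)ᵀ * blockD M = 1 := by
    simpa [transpose_mul] using congrArg transpose h4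
  have e : M = translation _ hS * levi U := by
    apply ext_blocks
    · simp [blockA_mul, translation, levi, U]
    · simp [blockB_mul, translation, levi, U, Matrix.mul_assoc, h5]
    · simp [blockC_mul, translation, levi, hM]
    · simp [blockD_mul, translation, levi, U]
  rw [e]
  exact mul_mem (hT _ _) (hU _)

/-- `Sp_{2g}(ℤ)` is generated by translations, the Levi subgroup and partial inversions. -/
theorem mem_of_generators_mem (hT : ∀ S hS, translation S hS ∈ K) (hU : ∀ U, levi U ∈ K)
    (hI : ∀ i, partialInversion i ∈ K) (M : siegelModularGroup g) : M ∈ K := by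
  have h : ∀ m ≤ g, ∃ N, M⁻¹ * N ∈ K ∧ RowsReduced m N := by
    intro m
    induction m with
    | zero => exact fun _ => ⟨M, by simp, fun a ha => absurd ha (by simp)⟩
    | succ m ih =>
      intro hm
      obtain ⟨N, hN, hr⟩ := ih (by omega)
      obtain ⟨N', hN', hr'⟩ := RowsReduced.exists_succ (r := ⟨m, hm⟩) hT hU hI hr
      exact ⟨N', by simpa [mul_assoc] using mul_mem hN hN', hr'⟩
  obtain ⟨N, hN, hr⟩ := h g le_rfl
  have hC : blockC N = 0 := by
    ext a j
    exact (hr a a.2).1 j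
  have := mul_mem (mem_of_blockC_eq_zero hT hU hC) (inv_mem hN)
  simpa using this

end Generation

/-! ### Counting even characteristics -/

/-- The vectors `x ∈ {0, 1}^g` with `v ⬝ x` even. -/
def evenHalf (v : Fin g → ℤ) : Finset (Fin g → Fin 2) :=
  Finset.univ.filter fun x => Even (v ⬝ᵥ lift x)

theorem mem_evenHalf {v : Fin g → ℤ} {x : Fin g → Fin 2} :
    x ∈ evenHalf v ↔ Even (v ⬝ᵥ lift x) := by
  simp [evenHalf]

theorem card_evenHalf_of_even {v : Fin g → ℤ} (hv : ∀ i, Even (v i)) :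
    (evenHalf v).card = 2 ^ g := by
  rw [evenHalf, Finset.filter_true_of_mem]
  · simp
  · exact fun x _ => Finset.even_sum _ fun i _ => (hv i).mul_right _

/-- Flipping the coordinate `i` exchanges the vectors of even and of odd pairing with `v`. -/
theorem two_mul_card_evenHalf_of_odd {v : Fin g → ℤ} {i : Fin g} (hv : Odd (v i)) :
    2 * (evenHalf v).card = 2 ^ g := by
  have hflip : ∀ x : Fin g → Fin 2,
      (Even (v ⬝ᵥ lift (Function.update x i (x i + 1))) ↔ ¬ Even (v ⬝ᵥ lift x)) := by
    intro x
    have h : ∀ a : Fin 2, Odd ((((a + 1 : Fin 2) : ℕ) : ℤ) - ((a : ℕ) : ℤ)) := by decide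
    have e : v ⬝ᵥ lift (Function.update x i (x i + 1)) - v ⬝ᵥ lift x
        = v i * ((((x i + 1 : Fin 2) : ℕ) : ℤ) - ((x i : ℕ) : ℤ)) := by
      rw [← dotProduct_sub, dotProduct, Finset.sum_eq_single i]
      · simp [lift]
      · intro j _ hj
        simp [lift, hj]
      · simp
    have h' := hv.mul (h (x i))
    rw [← e, Int.odd_sub, ← Int.not_even_iff_odd] at h'
    tauto
  have hinv : ∀ x : Fin g → Fin 2, Function.update (Function.update x i (x i + 1)) i
      (Function.update x i (x i + 1) i + 1) = x := by
    intro x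
    have : ∀ a : Fin 2, a + 1 + 1 = a := by decide
    simp [this]
  have hc : (evenHalf v).card = (Finset.univ.filter fun x => ¬ Even (v ⬝ᵥ lift x)).card := by
    refine Finset.card_bij' (fun x _ => Function.update x i (x i + 1))
      (fun x _ => Function.update x i (x i + 1)) ?_ ?_ (fun x _ => hinv x) (fun x _ => hinv x)
    · intro x hx
      rw [mem_evenHalf] at hx
      simpa only [Finset.mem_filter_univ, hflip, not_not] using hx
    · intro x hx
      simpa [mem_evenHalf, hflip] using hx
  have := Finset.card_filter_add_card_filter_not (s := (Finset.univ : Finset (Fin g → Fin 2)))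
    (fun x => Even (v ⬝ᵥ lift x))
  rw [← hc] at this
  simpa [two_mul, evenHalf] using this

theorem two_pow_dvd_card_evenHalf {n : ℕ} (v : Fin (n + 1) → ℤ) :
    2 ^ n ∣ (evenHalf v).card := by
  by_cases hv : ∀ i, Even (v i)
  · rw [card_evenHalf_of_even hv]
    exact pow_dvd_pow 2 n.le_succ
  · push Not at hv
    obtain ⟨i, hi⟩ := hv
    have := two_mul_card_evenHalf_of_odd (Int.not_even_iff_odd.mp hi)
    exact Dvd.intro_left 1 (by rw [pow_succ] at this; omega)

/-- Pointwise in `x`: among the parities of `v ⬝ x`, `m ⬝ x` and their sum, either all three are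
even or exactly one is. -/
theorem two_mul_card_evenHalf_inter (v m : Fin g → ℤ) :
    2 * (evenHalf v ∩ evenHalf m).card + 2 ^ g
      = (evenHalf v).card + (evenHalf m).card + (evenHalf (v + m)).card := by
  have h2 : 2 ^ g = (Finset.univ : Finset (Fin g → Fin 2)).card := by simp
  rw [evenHalf, evenHalf, evenHalf, ← Finset.filter_and, h2, Finset.card_eq_sum_ones Finset.univ]
  simp only [Finset.card_filter]
  rw [Finset.mul_sum, ← Finset.sum_add_distrib, ← Finset.sum_add_distrib, ← Finset.sum_add_distrib]
  refine Finset.sum_congr rfl fun x _ => ?_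
  simp only [add_dotProduct, Int.even_add]
  by_cases hv : Even (v ⬝ᵥ lift x) <;> by_cases hm : Even (m ⬝ᵥ lift x) <;> simp [hv, hm]

/-- Modulo `2` the sum counts the `x` in `evenHalf v` with `m ⬝ x` odd. By the intersection formula
both cardinalities involved are multiples of `2 ^ (g - 2)`, which is even for `g ≥ 3`. -/
theorem even_sum_evenHalf (hg : 3 ≤ g) (v m : Fin g → ℤ) :
    Even (∑ x ∈ evenHalf v, m ⬝ᵥ lift x) := by
  obtain ⟨n, rfl⟩ := Nat.exists_eq_add_of_le' hg
  have h1 : (∑ x ∈ evenHalf v, (1 - if Even (m ⬝ᵥ lift x) then (1 : ℤ) else 0))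
      = (evenHalf v).card - (evenHalf v ∩ evenHalf m).card := by
    rw [Finset.sum_sub_distrib, Finset.sum_boole, Finset.sum_const, nsmul_one]
    congr 3
    ext x
    simp [evenHalf]
  have h2 : Even (∑ x ∈ evenHalf v,
      (m ⬝ᵥ lift x - (1 - if Even (m ⬝ᵥ lift x) then (1 : ℤ) else 0))) := by
    refine Finset.even_sum _ fun x _ => ?_
    split_ifs with h
    · simpa using h
    · simpa [Int.even_sub] using h
  rw [Finset.sum_sub_distrib, h1, Int.even_sub] at h2
  rw [h2]
  obtain ⟨a, ha⟩ := two_pow_dvd_card_evenHalf v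
  obtain ⟨b, hb⟩ := two_pow_dvd_card_evenHalf m
  obtain ⟨c, hc⟩ := two_pow_dvd_card_evenHalf (v + m)
  have h3 := two_mul_card_evenHalf_inter v m
  have h4 : (evenHalf v ∩ evenHalf m).card + 2 ^ n * 4 = 2 ^ n * 2 * (a + b + c) := by
    have : n + 3 = n + 2 + 1 := rfl
    rw [ha, hb, hc, pow_succ, pow_add] at h3
    linarith
  have h5 : Even (evenHalf v ∩ evenHalf m).card := by
    rw [even_iff_two_dvd]
    have h7 : 2 ∣ (evenHalf v ∩ evenHalf m).card + 2 ^ n * 4 := by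
      rw [h4]
      exact Dvd.dvd.mul_right (Dvd.intro_left _ rfl) _
    omega
  have h6 : Even (evenHalf v).card := by
    rw [ha, pow_add]
    exact (Nat.even_mul.mpr (Or.inr (by decide))).mul_right _
  rw [Int.even_sub]
  norm_cast
  tauto

theorem sum_evenChars {α : Type*} [AddCommMonoid α] (F : (Fin g → Fin 2) × (Fin g → Fin 2) → α) :
    ∑ ε ∈ evenChars g, F ε = ∑ a, ∑ b ∈ evenHalf (lift a), F (a, b) := by
  simp only [evenChars, evenHalf, Finset.sum_filter]
  rw [Fintype.sum_prod_type]

theorem even_lift_apply_iff {a : Fin g → Fin 2} {i : Fin g} : Even (lift a i) ↔ a i = 0 := by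
  have : ∀ b : Fin 2, Even (((b : ℕ) : ℤ)) ↔ b = 0 := by decide
  exact this _

theorem exists_odd_lift_of_ne_zero {a : Fin g → Fin 2} (ha : a ≠ 0) : ∃ i, Odd (lift a i) := by
  by_contra! h
  refine ha (funext fun i => ?_)
  simpa [even_lift_apply_iff] using h i

theorem lift_zero : lift (0 : Fin g → Fin 2) = 0 := by
  ext i
  simp [lift]

theorem card_evenHalf_lift {n : ℕ} (a : Fin (n + 1) → Fin 2) :
    (evenHalf (lift a)).card = 2 ^ n + if a = 0 then 2 ^ n else 0 := by
  split_ifs with h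
  · rw [h, lift_zero, card_evenHalf_of_even (by simp), pow_succ]
    ring
  · obtain ⟨i, hi⟩ := exists_odd_lift_of_ne_zero h
    have := two_mul_card_evenHalf_of_odd hi
    rw [pow_succ] at this
    omega

theorem card_evenChars (n : ℕ) :
    (evenChars (n + 1)).card = 2 ^ n * (2 ^ (n + 1) + 1) := by
  rw [Finset.card_eq_sum_ones, sum_evenChars]
  simp only [← Finset.card_eq_sum_ones, card_evenHalf_lift, Finset.sum_add_distrib]
  simp
  ring

theorem chiWeight_eq (n : ℕ) : chiWeight (n + 2) = 2 ^ n * (2 ^ (n + 2) + 1) := by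
  rw [chiWeight, card_evenChars, pow_succ 2 n, mul_right_comm, Nat.mul_div_cancel _ two_pos]

theorem two_mul_chiWeight (hg : 2 ≤ g) : 2 * chiWeight g = (evenChars g).card := by
  obtain ⟨n, rfl⟩ := Nat.exists_eq_add_of_le' hg
  rw [chiWeight_eq, card_evenChars, pow_succ 2 n]
  ring

theorem even_chiWeight (hg : 3 ≤ g) : Even (chiWeight g) := by
  obtain ⟨n, rfl⟩ := Nat.exists_eq_add_of_le' hg
  rw [chiWeight_eq, pow_succ]
  exact (Nat.even_mul.mpr (Or.inr even_two)).mul_right _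

/-- The sum counts the `b` orthogonal to `a` modulo `2` with `b i = 1`. These two conditions are
independent, each halving the count, unless `a` is the basis vector at `i`, when they contradict
each other. -/
theorem sum_evenHalf_apply {n : ℕ} (i : Fin (n + 2)) (a : Fin (n + 2) → Fin 2) (ha : a i = 1) :
    (∑ b ∈ evenHalf (lift a), (b i : ℕ)) + (if a = Pi.single i 1 then 2 ^ n else 0) = 2 ^ n := by
  have hodd : Odd (lift a i) := by simp [lift, ha]
  have h1 := two_mul_card_evenHalf_of_odd hodd
  have h2 : 2 * (evenHalf (Pi.single i 1 : Fin (n + 2) → ℤ)).card = 2 ^ (n + 2) :=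
    two_mul_card_evenHalf_of_odd (i := i) (by simp)
  have h3 := two_mul_card_evenHalf_inter (lift a) (Pi.single i 1)
  have h4 : (∑ b ∈ evenHalf (lift a), (b i : ℕ)) + (evenHalf (lift a) ∩
      evenHalf (Pi.single i 1)).card = (evenHalf (lift a)).card := by
    have : evenHalf (lift a) ∩ evenHalf (Pi.single i 1)
        = (evenHalf (lift a)).filter fun b => b i = 0 := by
      ext b
      simp [mem_evenHalf, even_lift_apply_iff]
    rw [this, Finset.card_filter, ← Finset.sum_add_distrib, Finset.card_eq_sum_ones]
    refine Finset.sum_congr rfl fun b _ => ?_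
    have : ∀ c : Fin 2, (c : ℕ) + (if c = 0 then 1 else 0) = 1 := by decide
    exact this _
  have h5 : (evenHalf (lift a + Pi.single i 1)).card
      = 2 ^ (n + 1) + if a = Pi.single i 1 then 2 ^ (n + 1) else 0 := by
    split_ifs with h
    · rw [card_evenHalf_of_even, pow_succ]
      · ring
      · intro j
        rcases eq_or_ne j i with rfl | hj
        · simp [lift, h]
        · simp [lift, h, hj]
    · obtain ⟨j, hj⟩ : ∃ j, Odd ((lift a + Pi.single i 1 : Fin (n + 2) → ℤ) j) := by
        by_contra! h'
        refine h (funext fun j => ?_)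
        rcases eq_or_ne j i with rfl | hj
        · simpa using ha
        · simpa [hj, even_lift_apply_iff] using h' j
      have := two_mul_card_evenHalf_of_odd hj
      rw [pow_succ] at this
      omega
  rw [h5] at h3
  simp only [pow_succ] at h1 h2 h3 ⊢
  split_ifs at h3 ⊢ <;> omega

theorem four_dvd_chiWeight_add (hg : 3 ≤ g) (i : Fin g) :
    4 ∣ chiWeight g + ∑ ε ∈ evenChars g, (ε.1 i : ℕ) * (ε.2 i : ℕ) := by
  obtain ⟨n, rfl⟩ := Nat.exists_eq_add_of_le' hg
  have h1 : ∀ a : Fin (n + 3) → Fin 2,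
      (∑ b ∈ evenHalf (lift a), (a i : ℕ) * (b i : ℕ))
        + (if a = Pi.single i 1 then 2 ^ (n + 1) else 0)
        + (if Even ((Pi.single i 1 : Fin (n + 3) → ℤ) ⬝ᵥ lift a) then 2 ^ (n + 1) else 0)
        = 2 ^ (n + 1) := by
    intro a
    have h01 : ∀ c : Fin 2, c = 0 ∨ c = 1 := by decide
    rw [← Finset.mul_sum]
    simp only [single_one_dotProduct, even_lift_apply_iff]
    rcases h01 (a i) with h | h
    · have : a ≠ Pi.single i 1 := by
        rintro rfl
        simp at h
      simp [h, this]
    · rw [h]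
      simpa using sum_evenHalf_apply (n := n + 1) i a h
  have h2 := Finset.sum_congr (rfl : Finset.univ = Finset.univ) fun a _ => h1 a
  rw [Finset.sum_add_distrib, Finset.sum_add_distrib, ← Finset.sum_filter (p := fun a => Even _)]
    at h2
  have h3 : 2 * (evenHalf (Pi.single i 1 : Fin (n + 3) → ℤ)).card = 2 ^ (n + 3) :=
    two_mul_card_evenHalf_of_odd (i := i) (by simp)
  rw [sum_evenChars]
  simp only [Finset.sum_ite_eq', Finset.mem_univ, if_true, Finset.sum_const, smul_eq_mul,
    Finset.card_univ, Fintype.card_pi, Fintype.card_fin, Finset.prod_const] at h2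
  change _ + (evenHalf (Pi.single i 1 : Fin (n + 3) → ℤ)).card * _ = _ at h2
  have h4 : (evenHalf (Pi.single i 1 : Fin (n + 3) → ℤ)).card = 4 * 2 ^ n := by
    rw [pow_add] at h3
    omega
  rw [h4] at h2
  have h5 := chiWeight_eq (n + 1)
  set p := 2 ^ n with hp
  simp only [pow_succ, ← hp] at h2 h5
  -- With `g = n + 3` and `p = 2 ^ n`, the weight is `2p(8p + 1)` and the sum is `2p(4p - 1)`;
  -- together they make `24 p²`.
  refine ⟨6 * p * p, ?_⟩
  rw [h5]
  nlinarith

/-! ### Roots of unity and reduction of characteristics modulo 2 -/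

/-- `exp (2 π i r / 8)`. -/
def eighthRoot (r : ℤ) : ℂ := Complex.exp (Real.pi * Complex.I * (r / 4))

theorem eighthRoot_add (r s : ℤ) : eighthRoot (r + s) = eighthRoot r * eighthRoot s := by
  rw [eighthRoot, eighthRoot, eighthRoot, ← Complex.exp_add]
  congr 1
  push_cast
  ring

theorem eighthRoot_sum {ι : Type*} (s : Finset ι) (r : ι → ℤ) :
    ∏ x ∈ s, eighthRoot (r x) = eighthRoot (∑ x ∈ s, r x) := by
  simp only [eighthRoot, ← Complex.exp_sum, ← Finset.mul_sum, ← Finset.sum_div, Int.cast_sum]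

theorem eighthRoot_eq_one {r : ℤ} (h : 8 ∣ r) : eighthRoot r = 1 := by
  obtain ⟨m, rfl⟩ := h
  rw [eighthRoot, Complex.exp_eq_one_iff]
  exact ⟨m, by push_cast; ring⟩

/-- An integral vector, as a complex one. -/
def complexVec (v : Fin g → ℤ) : Fin g → ℂ := fun i => (v i : ℂ)

theorem complexVec_add (u v : Fin g → ℤ) : complexVec (u + v) = complexVec u + complexVec v := by
  ext i
  simp [complexVec]

theorem complexVec_smul (c : ℤ) (v : Fin g → ℤ) :
    complexVec (c • v) = (c : ℂ) • complexVec v := by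
  ext i
  simp [complexVec]

theorem complexVec_dotProduct (u v : Fin g → ℤ) :
    complexVec u ⬝ᵥ complexVec v = ((u ⬝ᵥ v : ℤ) : ℂ) := by
  simp [complexVec, dotProduct]

theorem map_mulVec_complexVec (S : Matrix (Fin g) (Fin g) ℤ) (v : Fin g → ℤ) :
    S.map (Int.cast : ℤ → ℂ) *ᵥ complexVec v = complexVec (S *ᵥ v) := by
  ext i
  simp [complexVec, dotProduct, mulVec]

theorem shifted_eq (ε n : Fin g → ℤ) :
    shifted ε n = complexVec n + (1 / 2 : ℂ) • complexVec ε := by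
  ext i
  simp [shifted, complexVec]
  ring

theorem thetaTerm_zero (ε₁ ε₂ : Fin g → ℤ) (τ : Matrix (Fin g) (Fin g) ℂ) (n : Fin g → ℤ) :
    thetaTerm ε₁ ε₂ 0 τ n = Complex.exp (Real.pi * Complex.I *
      (shifted ε₁ n ⬝ᵥ τ *ᵥ shifted ε₁ n + shifted ε₁ n ⬝ᵥ complexVec ε₂)) := by
  have : (fun i => (0 : Fin g → ℂ) i + (ε₂ i : ℂ) / 2) = (1 / 2 : ℂ) • complexVec ε₂ := by
    ext i
    simp [complexVec]
    ring
  rw [thetaTerm, this, dotProduct_smul, smul_eq_mul, one_div, mul_inv_cancel_left₀ two_ne_zero]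

theorem thetaNull_eq (ε₁ ε₂ : Fin g → ℤ) (τ : Matrix (Fin g) (Fin g) ℂ) :
    thetaNull ε₁ ε₂ τ = ∑' n, Complex.exp (Real.pi * Complex.I *
      (shifted ε₁ n ⬝ᵥ τ *ᵥ shifted ε₁ n + shifted ε₁ n ⬝ᵥ complexVec ε₂)) :=
  tsum_congr fun n => thetaTerm_zero ε₁ ε₂ τ n

theorem thetaNull_add_two_smul_left (ε₁ ε₂ m : Fin g → ℤ) (τ : Matrix (Fin g) (Fin g) ℂ) :
    thetaNull (ε₁ + (2 : ℤ) • m) ε₂ τ = thetaNull ε₁ ε₂ τ := by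
  rw [thetaNull_eq, thetaNull_eq]
  refine Eq.trans (tsum_congr fun n => ?_) ((Equiv.addRight m).tsum_eq _)
  have : shifted (ε₁ + (2 : ℤ) • m) n = shifted ε₁ (n + m) := by
    ext i
    simp [shifted]
    ring
  rw [this]
  rfl

theorem exp_eq_eighthRoot_mul {a b : ℂ} {r N : ℤ} (h : a = r / 4 + b + 2 * N) :
    Complex.exp (Real.pi * Complex.I * a)
      = eighthRoot r * Complex.exp (Real.pi * Complex.I * b) := by
  rw [eighthRoot, ← Complex.exp_add, h, Complex.exp_eq_exp_iff_exists_int]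
  exact ⟨N, by ring⟩

theorem thetaNull_add_two_smul_right (ε₁ ε₂ m : Fin g → ℤ) (τ : Matrix (Fin g) (Fin g) ℂ) :
    thetaNull ε₁ (ε₂ + (2 : ℤ) • m) τ = eighthRoot (4 * (ε₁ ⬝ᵥ m)) * thetaNull ε₁ ε₂ τ := by
  rw [thetaNull_eq, thetaNull_eq, ← tsum_mul_left]
  refine tsum_congr fun n => exp_eq_eighthRoot_mul (N := n ⬝ᵥ m) ?_
  simp only [complexVec_add, complexVec_smul, shifted_eq, dotProduct_add, add_dotProduct,
    dotProduct_smul, smul_dotProduct, complexVec_dotProduct, smul_eq_mul]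
  push_cast
  ring

/-- Reduction modulo `2`. -/
def red (v : Fin g → ℤ) : Fin g → Fin 2 := fun i => ⟨(v i % 2).toNat, by omega⟩

theorem lift_red_apply (v : Fin g → ℤ) (i : Fin g) : lift (red v) i = v i % 2 := by
  simp only [lift, red]
  omega

theorem eq_lift_red_add (v : Fin g → ℤ) :
    v = lift (red v) + (2 : ℤ) • fun i => v i / 2 := by
  ext i
  rw [Pi.add_apply, lift_red_apply, Pi.smul_apply, smul_eq_mul, Int.emod_add_mul_ediv]

theorem red_lift (a : Fin g → Fin 2) : red (lift a) = a := by
  have : ∀ b : Fin 2, (((b : ℕ) : ℤ) % 2).toNat = (b : ℕ) := by decide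
  ext i
  exact this _

theorem even_sub_of_red_eq {v w : Fin g → ℤ} (h : red v = red w) (i : Fin g) :
    Even (v i - w i) := by
  have h' : v i % 2 = w i % 2 := by rw [← lift_red_apply, ← lift_red_apply, h]
  rw [Int.even_iff]
  omega

theorem eq_of_even_sub_lift {a b : Fin g → Fin 2} (h : ∀ i, Even (lift a i - lift b i)) :
    a = b := by
  have : ∀ c d : Fin 2, Even (((c : ℕ) : ℤ) - ((d : ℕ) : ℤ)) → c = d := by decide
  exact funext fun i => this _ _ (h i)

theorem even_lift_red_dotProduct (u v : Fin g → ℤ) :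
    Even (lift (red u) ⬝ᵥ lift (red v)) ↔ Even (u ⬝ᵥ v) := by
  conv_rhs => rw [eq_lift_red_add u, eq_lift_red_add v]
  simp only [dotProduct_add, add_dotProduct, smul_dotProduct, dotProduct_smul, smul_eq_mul]
  simp [Int.even_add]

theorem thetaNull_eq_eighthRoot_mul (v w : Fin g → ℤ) (τ : Matrix (Fin g) (Fin g) ℂ) :
    thetaNull v w τ
      = eighthRoot (4 * (v ⬝ᵥ fun i => w i / 2)) * thetaNull (lift (red v)) (lift (red w)) τ := by
  conv_lhs => rw [eq_lift_red_add w, thetaNull_add_two_smul_right]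
  conv_lhs => enter [2]; rw [eq_lift_red_add v, thetaNull_add_two_smul_left]

theorem mem_evenChars {ε : (Fin g → Fin 2) × (Fin g → Fin 2)} :
    ε ∈ evenChars g ↔ Even (lift ε.1 ⬝ᵥ lift ε.2) := by
  simp [evenChars]

theorem image_evenChars
    {σ : (Fin g → Fin 2) × (Fin g → Fin 2) → (Fin g → Fin 2) × (Fin g → Fin 2)}
    (hσ : ∀ ε ∈ evenChars g, σ ε ∈ evenChars g) (hσ' : Function.Injective σ) :
    (evenChars g).image σ = evenChars g := by
  refine Finset.eq_of_subset_of_card_le (Finset.image_subset_iff.mpr hσ) ?_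
  rw [Finset.card_image_of_injective _ hσ']

theorem sum_evenChars_comp
    {σ : (Fin g → Fin 2) × (Fin g → Fin 2) → (Fin g → Fin 2) × (Fin g → Fin 2)}
    (hσ : ∀ ε ∈ evenChars g, σ ε ∈ evenChars g) (hσ' : Function.Injective σ)
    (F : (Fin g → Fin 2) × (Fin g → Fin 2) → ℤ) :
    ∑ ε ∈ evenChars g, F (σ ε) = ∑ ε ∈ evenChars g, F ε := by
  rw [← Finset.sum_image (f := F) fun _ _ _ _ h => hσ' h, image_evenChars hσ hσ']

/-- The common pattern for all generators: once the Thetanullwerte are permuted up to factors `c ε`,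
only the product of these factors has to be computed. -/
theorem chi_eq_of_thetaNull_eq
    {σ : (Fin g → Fin 2) × (Fin g → Fin 2) → (Fin g → Fin 2) × (Fin g → Fin 2)}
    (hσ : ∀ ε ∈ evenChars g, σ ε ∈ evenChars g) (hσ' : Function.Injective σ)
    {τ τ' : Matrix (Fin g) (Fin g) ℂ} (c : (Fin g → Fin 2) × (Fin g → Fin 2) → ℂ)
    (h : ∀ ε ∈ evenChars g, thetaNull (lift ε.1) (lift ε.2) τ'
      = c ε * thetaNull (lift (σ ε).1) (lift (σ ε).2) τ) :
    chi g τ' = (∏ ε ∈ evenChars g, c ε) * chi g τ := by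
  rw [chi, Finset.prod_congr rfl h, Finset.prod_mul_distrib, chi]
  congr 1
  conv_rhs => rw [← image_evenChars hσ hσ', Finset.prod_image fun _ _ _ _ h => hσ' h]

/-! ### Translations -/

section Translation

/-- Off-diagonal terms come in equal pairs `(i, j)`, `(j, i)`, and `n_i² ≡ n_i` modulo `2`. -/
theorem even_quadForm_sub (S : Matrix (Fin g) (Fin g) ℤ) (hS : S.IsSymm) (n : Fin g → ℤ) :
    Even (n ⬝ᵥ S *ᵥ n - n ⬝ᵥ S.diag) := by
  have h : n ⬝ᵥ S *ᵥ n - n ⬝ᵥ S.diag = ∑ i, (n i * n i - n i) * S i i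
      + ∑ p ∈ (Finset.univ : Finset (Fin g)).offDiag, n p.1 * (S p.1 p.2 * n p.2) := by
    simp only [dotProduct, mulVec, Finset.mul_sum, diag_apply]
    rw [← Finset.sum_product', Finset.univ_product_univ, ← Finset.univ_product_univ,
      ← Finset.diag_union_offDiag, Finset.sum_union (Finset.disjoint_diag_offDiag _),
      Finset.sum_diag, add_sub_right_comm, ← Finset.sum_sub_distrib]
    congr 1
    exact Finset.sum_congr rfl fun i _ => by ring
  rw [h]
  refine (Finset.even_sum _ fun i _ => ?_).add ?_
  · have : n i * n i - n i = (n i - 1) * (n i - 1 + 1) := by ring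
    rw [this]
    exact (Int.even_mul_succ_self _).mul_right _
  · rw [← ZMod.intCast_eq_zero_iff_even, Int.cast_sum]
    refine Finset.sum_involution (fun p _ => p.swap) ?_ ?_ ?_ ?_
    · rintro ⟨i, j⟩ _
      simp only [Prod.fst_swap, Prod.snd_swap]
      rw [← Int.cast_add, ZMod.intCast_eq_zero_iff_even, hS.apply i j]
      exact ⟨n i * (S i j * n j), by ring⟩
    · rintro ⟨i, j⟩ hp _ he
      simp at hp he
      exact hp he.2
    · rintro ⟨i, j⟩ hp
      simp at hp ⊢
      exact fun h => hp h.symm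
    · rintro ⟨i, j⟩ _
      rfl

theorem act_translation (S : Matrix (Fin g) (Fin g) ℤ) (hS : S.IsSymm)
    (τ : Matrix (Fin g) (Fin g) ℂ) :
    act (translation S hS) τ = τ + S.map (Int.cast : ℤ → ℂ) := by
  simp [act, num, denom, translation]

theorem autFactor_translation (S : Matrix (Fin g) (Fin g) ℤ) (hS : S.IsSymm)
    (τ : Matrix (Fin g) (Fin g) ℂ) : autFactor (translation S hS) τ = 1 := by
  simp [autFactor, denom, translation]

theorem thetaNull_add_intCast (S : Matrix (Fin g) (Fin g) ℤ) (hS : S.IsSymm) (ε₁ ε₂ : Fin g → ℤ)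
    (τ : Matrix (Fin g) (Fin g) ℂ) :
    thetaNull ε₁ ε₂ (τ + S.map (Int.cast : ℤ → ℂ))
      = eighthRoot (-(ε₁ ⬝ᵥ S *ᵥ ε₁ + 2 * (ε₁ ⬝ᵥ S.diag)))
        * thetaNull ε₁ (ε₂ + S *ᵥ ε₁ + S.diag) τ := by
  rw [thetaNull_eq, thetaNull_eq, ← tsum_mul_left]
  refine tsum_congr fun n => ?_
  obtain ⟨N, hN⟩ := even_quadForm_sub S hS n
  refine exp_eq_eighthRoot_mul (N := N) ?_
  have hs : ε₁ ⬝ᵥ S *ᵥ n = n ⬝ᵥ S *ᵥ ε₁ := by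
    rw [dotProduct_comm, ← vecMul_transpose, hS.eq, dotProduct_mulVec]
  have hN' := congrArg (Int.cast : ℤ → ℂ) hN
  push_cast at hN'
  rw [add_mulVec, dotProduct_add]
  simp only [complexVec_add, shifted_eq, mulVec_add, mulVec_smul, map_mulVec_complexVec,
    dotProduct_add, add_dotProduct, dotProduct_smul, smul_dotProduct, complexVec_dotProduct,
    smul_eq_mul, hs]
  push_cast
  linear_combination hN'

theorem evenHalf_zero : evenHalf (0 : Fin g → ℤ) = Finset.univ := by
  simp [evenHalf]

/-- Each `a ≠ 0` is the first half of `2 ^ (g - 1)` even characteristics, a multiple of `4`, while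
`a = 0` contributes nothing. The remaining factor `2` comes from the sum over all `a`, which modulo
`2` is a sum of values of a linear form. -/
theorem eight_dvd_sum_quadForm (hg : 3 ≤ g) (S : Matrix (Fin g) (Fin g) ℤ) (hS : S.IsSymm) :
    8 ∣ ∑ ε ∈ evenChars g, lift ε.1 ⬝ᵥ S *ᵥ lift ε.1 := by
  have h1 : Even (∑ a : Fin g → Fin 2, lift a ⬝ᵥ S *ᵥ lift a) := by
    have h := even_sum_evenHalf hg 0 S.diag
    rw [evenHalf_zero] at h
    have h' := Finset.even_sum (s := (Finset.univ : Finset (Fin g → Fin 2)))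
      (f := fun a => lift a ⬝ᵥ S *ᵥ lift a - lift a ⬝ᵥ S.diag)
      fun a _ => even_quadForm_sub S hS (lift a)
    simp only [dotProduct_comm _ S.diag] at h'
    rw [Finset.sum_sub_distrib] at h'
    exact (Int.even_sub.mp h').mpr h
  obtain ⟨n, rfl⟩ := Nat.exists_eq_add_of_le' hg
  have h2 : ∑ ε ∈ evenChars (n + 3), lift ε.1 ⬝ᵥ S *ᵥ lift ε.1
      = 2 ^ (n + 2) * ∑ a : Fin (n + 3) → Fin 2, lift a ⬝ᵥ S *ᵥ lift a := by
    rw [sum_evenChars, Finset.mul_sum]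
    refine Finset.sum_congr rfl fun a _ => ?_
    simp only [Finset.sum_const]
    rw [card_evenHalf_lift, nsmul_eq_mul]
    split_ifs with h
    · simp [h, lift_zero]
    · simp
  obtain ⟨m, hm⟩ := h1
  exact ⟨2 ^ n * m, by rw [h2, hm]; ring⟩

theorem chi_add_intCast (hg : 3 ≤ g) (S : Matrix (Fin g) (Fin g) ℤ) (hS : S.IsSymm)
    (τ : Matrix (Fin g) (Fin g) ℂ) :
    chi g (τ + S.map (Int.cast : ℤ → ℂ)) = chi g τ := by
  let w : (Fin g → Fin 2) × (Fin g → Fin 2) → Fin g → ℤ :=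
    fun ε => lift ε.2 + S *ᵥ lift ε.1 + S.diag
  let σ : (Fin g → Fin 2) × (Fin g → Fin 2) → (Fin g → Fin 2) × (Fin g → Fin 2) :=
    fun ε => (ε.1, red (w ε))
  have hw : ∀ ε, lift ε.1 ⬝ᵥ w ε = lift ε.1 ⬝ᵥ lift ε.2
      + (lift ε.1 ⬝ᵥ S *ᵥ lift ε.1 + lift ε.1 ⬝ᵥ S.diag) := fun ε => by
    simp only [w, dotProduct_add, add_assoc]
  have hσ : ∀ ε ∈ evenChars g, σ ε ∈ evenChars g := by
    intro ε hε
    rw [mem_evenChars] at hε ⊢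
    simp only [σ]
    have h := even_lift_red_dotProduct (lift ε.1) (w ε)
    rw [red_lift] at h
    rw [h, hw]
    refine hε.add ?_
    have := even_quadForm_sub S hS (lift ε.1)
    rwa [Int.even_sub, ← Int.even_add] at this
  have hσ' : Function.Injective σ := by
    rintro ⟨a, b⟩ ⟨a', b'⟩ h
    obtain ⟨rfl, h2⟩ := Prod.mk.inj h
    congr 1
    refine eq_of_even_sub_lift fun i => ?_
    simpa [w] using even_sub_of_red_eq h2 i
  rw [chi_eq_of_thetaNull_eq hσ hσ' (τ := τ) fun ε =>
    eighthRoot (-(lift ε.1 ⬝ᵥ S *ᵥ lift ε.1 + 2 * (lift ε.1 ⬝ᵥ S.diag))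
      + 4 * (lift ε.1 ⬝ᵥ fun i => w ε i / 2))]
  · rw [eighthRoot_sum, eighthRoot_eq_one, one_mul]
    -- Writing `w ε` as its reduction plus twice its half exhibits the exponent as a quadratic form
    -- plus a difference `F ε - F (σ ε)`, whose sum vanishes because `σ` permutes the even
    -- characteristics.
    have h : ∀ ε, -(lift ε.1 ⬝ᵥ S *ᵥ lift ε.1 + 2 * (lift ε.1 ⬝ᵥ S.diag))
        + 4 * (lift ε.1 ⬝ᵥ fun i => w ε i / 2)
        = lift ε.1 ⬝ᵥ S *ᵥ lift ε.1 + 2 * (lift ε.1 ⬝ᵥ lift ε.2)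
          - 2 * (lift (σ ε).1 ⬝ᵥ lift (σ ε).2) := by
      intro ε
      have h1 := hw ε
      rw [eq_lift_red_add (w ε), dotProduct_add, dotProduct_smul, smul_eq_mul] at h1
      simp only [σ]
      linarith
    simp only [h]
    rw [Finset.sum_sub_distrib, sum_evenChars_comp hσ hσ' fun ε => 2 * (lift ε.1 ⬝ᵥ lift ε.2),
      Finset.sum_add_distrib, add_sub_cancel_right]
    exact eight_dvd_sum_quadForm hg S hS
  · intro ε _
    rw [thetaNull_add_intCast S hS, thetaNull_eq_eighthRoot_mul, red_lift, eighthRoot_add,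
      mul_assoc]

end Translation

/-! ### Levi elements -/

section Levi

variable (U : (Matrix (Fin g) (Fin g) ℤ)ˣ)

theorem act_levi (τ : Matrix (Fin g) (Fin g) ℂ) : act (levi U) τ
    = U.1.map (Int.cast : ℤ → ℂ) * τ * (U.1.map (Int.cast : ℤ → ℂ))ᵀ := by
  have h : ((U⁻¹).1ᵀ.map (Int.cast : ℤ → ℂ))⁻¹ = (U.1.map (Int.cast : ℤ → ℂ))ᵀ := by
    refine inv_eq_right_inv ?_
    rw [← transpose_map, ← Matrix.map_mul_intCast, ← transpose_mul, Units.mul_inv]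
    simp
  rw [← h]
  simp only [act, num, denom, levi, blockA_ofBlocks, blockB_ofBlocks, blockC_ofBlocks,
    blockD_ofBlocks]
  simp only [Matrix.map_zero _ Int.cast_zero, zero_mul, add_zero, zero_add]

theorem autFactor_levi_pow (τ : Matrix (Fin g) (Fin g) ℂ) {k : ℕ} (hk : Even k) :
    autFactor (levi U) τ ^ k = 1 := by
  have h : IsUnit (U⁻¹).1ᵀ.det := by
    rw [det_transpose]
    exact (Matrix.isUnit_iff_isUnit_det _).mp (U⁻¹).isUnit
  have e : autFactor (levi U) τ = (((U⁻¹).1ᵀ.det : ℤ) : ℂ) := by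
    simp only [autFactor, denom, levi, blockC_ofBlocks, blockD_ofBlocks]
    rw [Int.cast_det]
    simp
  obtain ⟨m, rfl⟩ := hk
  rw [e]
  rcases Int.isUnit_iff.mp h with h | h <;> rw [h] <;> simp [← two_mul, pow_mul]

theorem thetaNull_levi (ε₁ ε₂ : Fin g → ℤ) (τ : Matrix (Fin g) (Fin g) ℂ) :
    thetaNull ε₁ ε₂ (U.1.map (Int.cast : ℤ → ℂ) * τ * (U.1.map (Int.cast : ℤ → ℂ))ᵀ)
      = thetaNull (U.1ᵀ *ᵥ ε₁) ((U⁻¹).1 *ᵥ ε₂) τ := by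
  let e : (Fin g → ℤ) ≃ (Fin g → ℤ) :=
    { toFun := fun n => U.1ᵀ *ᵥ n
      invFun := fun n => (U⁻¹).1ᵀ *ᵥ n
      left_inv := fun n => by
        simp only
        rw [mulVec_mulVec, ← transpose_mul, Units.mul_inv, transpose_one, one_mulVec]
      right_inv := fun n => by
        simp only
        rw [mulVec_mulVec, ← transpose_mul, Units.inv_mul, transpose_one, one_mulVec] }
  rw [thetaNull_eq, thetaNull_eq]
  refine Eq.trans (tsum_congr fun n => ?_) (e.tsum_eq _)
  have h1 : shifted (U.1ᵀ *ᵥ ε₁) (e n) = (U.1.map (Int.cast : ℤ → ℂ))ᵀ *ᵥ shifted ε₁ n := by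
    change shifted _ (U.1ᵀ *ᵥ n) = _
    rw [shifted_eq, shifted_eq, mulVec_add, mulVec_smul, ← transpose_map, map_mulVec_complexVec,
      map_mulVec_complexVec]
  have h2 : (U.1.map (Int.cast : ℤ → ℂ))ᵀ *ᵥ shifted ε₁ n ⬝ᵥ complexVec ((U⁻¹).1 *ᵥ ε₂)
      = shifted ε₁ n ⬝ᵥ complexVec ε₂ := by
    rw [mulVec_transpose, ← dotProduct_mulVec, map_mulVec_complexVec, mulVec_mulVec,
      Units.mul_inv, one_mulVec]
  rw [h1, h2, ← mulVec_mulVec, ← mulVec_mulVec, dotProduct_mulVec, ← mulVec_transpose]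

theorem chi_levi (hg : 3 ≤ g) (τ : Matrix (Fin g) (Fin g) ℂ) :
    chi g (U.1.map (Int.cast : ℤ → ℂ) * τ * (U.1.map (Int.cast : ℤ → ℂ))ᵀ) = chi g τ := by
  let v : (Fin g → Fin 2) → Fin g → ℤ := fun a => U.1ᵀ *ᵥ lift a
  let w : (Fin g → Fin 2) → Fin g → ℤ := fun b => (U⁻¹).1 *ᵥ lift b
  let σ : (Fin g → Fin 2) × (Fin g → Fin 2) → (Fin g → Fin 2) × (Fin g → Fin 2) :=
    fun ε => (red (v ε.1), red (w ε.2))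
  have hvw : ∀ ε : (Fin g → Fin 2) × (Fin g → Fin 2),
      v ε.1 ⬝ᵥ w ε.2 = lift ε.1 ⬝ᵥ lift ε.2 := by
    intro ε
    simp only [v, w]
    rw [mulVec_transpose, ← dotProduct_mulVec, mulVec_mulVec, Units.mul_inv, one_mulVec]
  have hσ : ∀ ε ∈ evenChars g, σ ε ∈ evenChars g := by
    intro ε hε
    rw [mem_evenChars] at hε ⊢
    rwa [even_lift_red_dotProduct, hvw]
  have hinj : ∀ (V W : Matrix (Fin g) (Fin g) ℤ), W * V = 1 → ∀ a b : Fin g → Fin 2,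
      red (V *ᵥ lift a) = red (V *ᵥ lift b) → a = b := by
    intro V W hWV a b h
    refine eq_of_even_sub_lift fun i => ?_
    have : lift a - lift b = W *ᵥ (V *ᵥ lift a - V *ᵥ lift b) := by
      rw [mulVec_sub, mulVec_mulVec, mulVec_mulVec, hWV, one_mulVec, one_mulVec]
    rw [← Pi.sub_apply, this, mulVec, dotProduct]
    exact Finset.even_sum _ fun j _ => (even_sub_of_red_eq h j).mul_left _
  have hσ' : Function.Injective σ := by
    rintro ⟨a, b⟩ ⟨a', b'⟩ h
    obtain ⟨h1, h2⟩ := Prod.mk.inj h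
    rw [hinj _ (U⁻¹).1ᵀ (by rw [← transpose_mul, Units.mul_inv, transpose_one]) a a' h1,
      hinj _ U.1 (by rw [Units.mul_inv]) b b' h2]
  rw [chi_eq_of_thetaNull_eq hσ hσ' (τ := τ) fun ε =>
    eighthRoot (4 * (v ε.1 ⬝ᵥ fun i => w ε.2 i / 2))]
  · rw [eighthRoot_sum, eighthRoot_eq_one, one_mul]
    let u : (Fin g → Fin 2) → Fin g → ℤ := fun a => (U⁻¹).1ᵀ *ᵥ fun i => v a i / 2
    -- Modulo `8` and up to a difference `F ε - F (σ ε)`, the exponent is `4` times a form linear in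
    -- `ε.2` for fixed `ε.1`, so that `even_sum_evenHalf` applies to each inner sum.
    have h : ∀ ε : (Fin g → Fin 2) × (Fin g → Fin 2), 4 * (v ε.1 ⬝ᵥ fun i => w ε.2 i / 2)
        = 2 * (lift ε.1 ⬝ᵥ lift ε.2) - 2 * (lift (σ ε).1 ⬝ᵥ lift (σ ε).2)
          - 4 * (u ε.1 ⬝ᵥ lift ε.2)
          + 8 * ((fun i => v ε.1 i / 2) ⬝ᵥ fun i => w ε.2 i / 2) := by
      intro ε
      have h1 : u ε.1 ⬝ᵥ lift ε.2 = (fun i => v ε.1 i / 2) ⬝ᵥ w ε.2 := by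
        simp only [u, w]
        rw [mulVec_transpose, ← dotProduct_mulVec]
      rw [h1, ← hvw]
      simp only [σ]
      have hv := eq_lift_red_add (v ε.1)
      have hw := eq_lift_red_add (w ε.2)
      set V := v ε.1
      set W := w ε.2
      set hV : Fin g → ℤ := fun i => V i / 2
      set hW : Fin g → ℤ := fun i => W i / 2
      have e1 : V ⬝ᵥ W = V ⬝ᵥ lift (red W) + 2 * (V ⬝ᵥ hW) := by
        conv_lhs => rw [hw, dotProduct_add, dotProduct_smul, smul_eq_mul]
      have e2 : V ⬝ᵥ lift (red W) = lift (red V) ⬝ᵥ lift (red W) + 2 * (hV ⬝ᵥ lift (red W)) := by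
        conv_lhs => rw [hv, add_dotProduct, smul_dotProduct, smul_eq_mul]
      have e3 : hV ⬝ᵥ W = hV ⬝ᵥ lift (red W) + 2 * (hV ⬝ᵥ hW) := by
        conv_lhs => rw [hw, dotProduct_add, dotProduct_smul, smul_eq_mul]
      linarith
    simp only [h]
    rw [Finset.sum_add_distrib, Finset.sum_sub_distrib, Finset.sum_sub_distrib,
      sum_evenChars_comp hσ hσ' fun ε => 2 * (lift ε.1 ⬝ᵥ lift ε.2), sub_self, zero_sub]
    refine dvd_add ((dvd_neg).mpr ?_) (Finset.dvd_sum fun _ _ => Dvd.intro _ rfl)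
    rw [← Finset.mul_sum, sum_evenChars]
    obtain ⟨m, hm⟩ := Finset.even_sum (s := (Finset.univ : Finset (Fin g → Fin 2)))
      (f := fun a => ∑ b ∈ evenHalf (lift a), u a ⬝ᵥ lift b) fun a _ => even_sum_evenHalf hg (lift a) (u a)
    exact ⟨m, by rw [hm]; ring⟩
  · intro ε _
    rw [thetaNull_levi, thetaNull_eq_eighthRoot_mul]

end Levi

/-! ### Partial inversions -/

section PartialInversion

theorem denom_partialInversion_mulVec (i : Fin g) (τ : Matrix (Fin g) (Fin g) ℂ)
    (x : Fin g → ℂ) :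
    denom (partialInversion i) τ *ᵥ x = x + Pi.single i ((τ *ᵥ x) i - x i) := by
  ext j
  simp only [denom, partialInversion, blockC_ofBlocks, blockD_ofBlocks, add_mulVec,
    ← mulVec_mulVec]
  rw [Matrix.map_sub _ Int.cast_sub, sub_mulVec, Matrix.map_one _ Int.cast_zero Int.cast_one,
    one_mulVec, diagonal_map Int.cast_zero]
  rcases eq_or_ne j i with rfl | hj
  · simp [mulVec_diagonal, -mulVec_mulVec]
  · simp [mulVec_diagonal, -mulVec_mulVec, hj]

theorem num_partialInversion_mulVec (i : Fin g) (τ : Matrix (Fin g) (Fin g) ℂ)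
    (x : Fin g → ℂ) :
    num (partialInversion i) τ *ᵥ x = τ *ᵥ x + Pi.single i (-((τ *ᵥ x) i) - x i) := by
  ext j
  simp only [num, partialInversion, blockA_ofBlocks, blockB_ofBlocks, add_mulVec,
    ← mulVec_mulVec]
  rw [Matrix.map_sub _ Int.cast_sub, sub_mulVec, Matrix.map_one _ Int.cast_zero Int.cast_one,
    one_mulVec, diagonal_neg, diagonal_map Int.cast_zero, diagonal_map Int.cast_zero]
  rcases eq_or_ne j i with rfl | hj
  · simp [mulVec_diagonal, -mulVec_mulVec]
    ring
  · simp [mulVec_diagonal, -mulVec_mulVec, hj]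

theorem autFactor_partialInversion (i : Fin g) (τ : Matrix (Fin g) (Fin g) ℂ) :
    autFactor (partialInversion i) τ = τ i i := by
  have h : denom (partialInversion i) τ = (1 : Matrix (Fin g) (Fin g) ℂ).updateRow i (τ i) := by
    ext j l
    have := congrFun (denom_partialInversion_mulVec i τ (Pi.single l 1)) j
    rw [mulVec_single_one, mulVec_single_one] at this
    change denom (partialInversion i) τ j l = _ at this
    rw [this]
    rcases eq_or_ne j i with rfl | hj
    · simp
    · simp [hj, Matrix.one_apply, Pi.single_apply]
  rw [autFactor, h, ← cramer_transpose_apply, transpose_one, cramer_one]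
  rfl

theorem im_apply_self_pos {τ : Matrix (Fin g) (Fin g) ℂ} (hτ : τ ∈ upperHalfSpace g) (i : Fin g) :
    0 < (τ i i).im := by
  simpa using hτ.2.diag_pos (i := i)

theorem apply_self_ne_zero {τ : Matrix (Fin g) (Fin g) ℂ} (hτ : τ ∈ upperHalfSpace g)
    (i : Fin g) : τ i i ≠ 0 := fun h => by
  simpa [h] using im_apply_self_pos hτ i

theorem quadForm_add_single {τ : Matrix (Fin g) (Fin g) ℂ} (hτ : τ.IsSymm) (i : Fin g)
    (w : Fin g → ℂ) (b : ℂ) :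
    (w + Pi.single i b) ⬝ᵥ τ *ᵥ (w + Pi.single i b)
      = w ⬝ᵥ τ *ᵥ w + 2 * b * (τ *ᵥ w) i + b ^ 2 * τ i i := by
  have h : w ⬝ᵥ τ *ᵥ Pi.single i b = b * (τ *ᵥ w) i := by
    rw [dotProduct_mulVec, ← mulVec_transpose, hτ.eq, dotProduct_single, mul_comm]
  have h' : (τ *ᵥ Pi.single i b) i = b * τ i i := by
    simp [mul_comm]
  rw [mulVec_add, dotProduct_add, add_dotProduct, add_dotProduct, h, single_dotProduct,
    single_dotProduct, h']
  ring

/-- Instead of inverting `C τ + D`, one solves `(C τ + D) x = w + a e_i`. Since `C τ + D` replaces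
`x i` by `(τ x) i`, the solution is `x = w + b e_i` with `b` fixed by `(τ x) i = a`; then `M.τ`
sends `w + a e_i` to `(A τ + B) x`. -/
theorem quadForm_act_partialInversion {τ : Matrix (Fin g) (Fin g) ℂ} (hτ : τ ∈ upperHalfSpace g)
    (i : Fin g) {w : Fin g → ℂ} (hw : w i = 0) (a : ℂ) :
    (w + Pi.single i a) ⬝ᵥ act (partialInversion i) τ *ᵥ (w + Pi.single i a)
      = w ⬝ᵥ τ *ᵥ w - (a - (τ *ᵥ w) i) ^ 2 / τ i i := by
  have ht := apply_self_ne_zero hτ i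
  set s := (τ *ᵥ w) i with hs
  set b := (a - s) / τ i i with hb
  have hbt : b * τ i i = a - s := div_mul_cancel₀ _ ht
  set x := w + Pi.single i b with hx
  have h0 : w ⬝ᵥ τ *ᵥ Pi.single i b = b * s := by
    rw [dotProduct_mulVec, ← mulVec_transpose, hτ.1.eq, dotProduct_single, mul_comm]
  have h1 : (τ *ᵥ x) i = a := by
    have : (τ *ᵥ Pi.single i b) i = b * τ i i := by simp [mul_comm]
    rw [hx, mulVec_add, Pi.add_apply, this, hbt, ← hs]
    ring
  have h2 : x i = b := by simp [hx, hw]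
  have h3 : denom (partialInversion i) τ *ᵥ x = w + Pi.single i a := by
    rw [denom_partialInversion_mulVec, h1, h2, hx, add_assoc, ← Pi.single_add, add_sub_cancel]
  have h4 : act (partialInversion i) τ *ᵥ (w + Pi.single i a)
      = τ *ᵥ w + τ *ᵥ Pi.single i b + Pi.single i (-a - b) := by
    rw [← h3, mulVec_mulVec, act_mul_denom _ hτ, num_partialInversion_mulVec, h1, h2, hx,
      mulVec_add]
  have h5 : (τ *ᵥ w + τ *ᵥ Pi.single i b) i = a := by
    rw [← mulVec_add, ← hx, h1]
  rw [h4, add_dotProduct, dotProduct_add, dotProduct_add, h0, dotProduct_single, hw, zero_mul,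
    single_dotProduct, Pi.add_apply, h5, Pi.single_eq_same]
  rw [hb]
  field_simp
  ring

theorem tsum_exp_inversion {t : ℂ} (ht : 0 < t.im) (s : ℂ) (e₁ e₂ : ℤ) :
    ∑' k : ℤ, Complex.exp (Real.pi * Complex.I *
        (-((k + e₁ / 2 - s) ^ 2 / t) + (k + e₁ / 2) * e₂))
      = (-Complex.I * t) ^ (1 / 2 : ℂ) * eighthRoot (2 * (e₁ * e₂)) *
        ∑' k : ℤ, Complex.exp (Real.pi * Complex.I *
          (2 * (k + e₂ / 2) * s + (k + e₂ / 2) ^ 2 * t - (k + e₂ / 2) * e₁)) := by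
  have ht0 : t ≠ 0 := fun h => by simp [h] at ht
  -- This `z` absorbs the shift by `e₁ / 2` and the linear phase `e₂` into the square: `-(k - z)² /
  -- t` is the exponent on the left up to terms free of `k`.
  set z : ℂ := s - e₁ / 2 + t * e₂ / 2 with hz
  have hr : (-Complex.I * t) ^ (1 / 2 : ℂ) ≠ 0 := by
    simp [Complex.cpow_eq_zero_iff, ht0]
  have hF : (-Complex.I * t) ^ (1 / 2 : ℂ) * jacobiTheta₂ z t
      = Complex.exp (-Real.pi * Complex.I * z ^ 2 / t) * jacobiTheta₂ (z / t) (-1 / t) := by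
    rw [jacobiTheta₂_functional_equation z t]
    field_simp
  have hL : ∑' k : ℤ, Complex.exp (Real.pi * Complex.I *
        (-((k + e₁ / 2 - s) ^ 2 / t) + (k + e₁ / 2) * e₂))
      = Complex.exp (Real.pi * Complex.I * (t * e₂ ^ 2 / 4 + s * e₂)) *
        (Complex.exp (-Real.pi * Complex.I * z ^ 2 / t) * jacobiTheta₂ (z / t) (-1 / t)) := by
    rw [jacobiTheta₂, ← tsum_mul_left, ← tsum_mul_left]
    refine tsum_congr fun k => ?_
    rw [jacobiTheta₂_term, ← Complex.exp_add, ← Complex.exp_add, hz]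
    congr 1
    field_simp
    ring
  rw [hL, ← hF, jacobiTheta₂, mul_left_comm, mul_assoc (_ ^ _)]
  refine congrArg _ ?_
  rw [← tsum_mul_left, ← tsum_mul_left]
  refine tsum_congr fun k => ?_
  rw [jacobiTheta₂_term, eighthRoot, ← Complex.exp_add, ← Complex.exp_add, hz]
  congr 1
  push_cast
  ring

/-- Separates the `i`-th coordinate of a vector from the others. -/
def splitCoord (i : Fin g) : ({j : Fin g // j ≠ i} → ℤ) × ℤ ≃ (Fin g → ℤ) where
  toFun p := fun j => if h : j = i then p.2 else p.1 ⟨j, h⟩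
  invFun n := (fun j => n j, n i)
  left_inv p := by
    ext j
    · simp [j.2]
    · simp
  right_inv n := by
    ext j
    by_cases h : j = i
    · simp [h]
    · simp [h]

/-- The vector `n + ε / 2` with its `i`-th coordinate replaced by zero. -/
def shiftedOff (i : Fin g) (ε : Fin g → ℤ) (r : {j : Fin g // j ≠ i} → ℤ) : Fin g → ℂ :=
  fun j => if h : j = i then 0 else (r ⟨j, h⟩ : ℂ) + (ε j : ℂ) / 2

theorem shifted_splitCoord (i : Fin g) (ε : Fin g → ℤ) (r : {j : Fin g // j ≠ i} → ℤ) (k : ℤ) :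
    shifted ε (splitCoord i (r, k))
      = shiftedOff i ε r + Pi.single i ((k : ℂ) + (ε i : ℂ) / 2) := by
  ext j
  by_cases h : j = i
  · subst h
    simp [shifted, splitCoord, shiftedOff]
  · simp [shifted, splitCoord, shiftedOff, h]

theorem shiftedOff_self (i : Fin g) (ε : Fin g → ℤ) (r : {j : Fin g // j ≠ i} → ℤ) :
    shiftedOff i ε r i = 0 := by
  simp [shiftedOff]

theorem thetaNull_eq_tsum_splitCoord (i : Fin g) (ε₁ ε₂ : Fin g → ℤ)
    {τ : Matrix (Fin g) (Fin g) ℂ} (hτ : τ ∈ upperHalfSpace g) :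
    thetaNull ε₁ ε₂ τ = ∑' (r : {j : Fin g // j ≠ i} → ℤ) (k : ℤ),
      thetaTerm ε₁ ε₂ 0 τ (splitCoord i (r, k)) := by
  rw [thetaNull, theta, ← (splitCoord i).tsum_eq, Summable.tsum_prod]
  exact (splitCoord i).summable_iff.mpr (summable_thetaTerm ε₁ ε₂ 0 hτ)

/-- With the other coordinates of the summation index fixed, the sum over the `i`-th one is a
one-variable theta series, to which `tsum_exp_inversion` applies with `t = τ i i` and `s = (τ w) i`.
Absolute convergence permits the iterated summation. -/
theorem thetaNull_partialInversion (i : Fin g) (ε₁ ε₂ : Fin g → ℤ)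
    {τ : Matrix (Fin g) (Fin g) ℂ} (hτ : τ ∈ upperHalfSpace g) :
    thetaNull ε₁ ε₂ (act (partialInversion i) τ)
      = (-Complex.I * τ i i) ^ (1 / 2 : ℂ) * eighthRoot (2 * (ε₁ i * ε₂ i)) *
        thetaNull (Function.update ε₁ i (ε₂ i)) (Function.update ε₂ i (-ε₁ i)) τ := by
  rw [thetaNull_eq_tsum_splitCoord i _ _ (act_mem _ hτ), thetaNull_eq_tsum_splitCoord i _ _ hτ,
    ← tsum_mul_left]
  refine tsum_congr fun r => ?_
  set w := shiftedOff i ε₁ r with hw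
  have hwi : w i = 0 := shiftedOff_self i ε₁ r
  have hw' : shiftedOff i (Function.update ε₁ i (ε₂ i)) r = w := by
    ext j
    by_cases h : j = i <;> simp [hw, shiftedOff, h]
  have hwe : w ⬝ᵥ complexVec (Function.update ε₂ i (-ε₁ i)) = w ⬝ᵥ complexVec ε₂ := by
    refine Finset.sum_congr rfl fun j _ => ?_
    by_cases h : j = i
    · rw [h, hwi, zero_mul, zero_mul]
    · simp [complexVec, h]
  set c := Complex.exp (Real.pi * Complex.I * (w ⬝ᵥ τ *ᵥ w + w ⬝ᵥ complexVec ε₂))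
  have hL : ∀ k : ℤ, thetaTerm ε₁ ε₂ 0 (act (partialInversion i) τ) (splitCoord i (r, k))
      = c * Complex.exp (Real.pi * Complex.I *
        (-(((k : ℂ) + ε₁ i / 2 - (τ *ᵥ w) i) ^ 2 / τ i i) + (k + ε₁ i / 2) * ε₂ i)) := by
    intro k
    rw [thetaTerm_zero, shifted_splitCoord, ← hw, quadForm_act_partialInversion hτ i hwi,
      add_dotProduct, single_dotProduct, ← Complex.exp_add]
    congr 1
    simp only [complexVec]
    ring
  have hR : ∀ k : ℤ, thetaTerm (Function.update ε₁ i (ε₂ i)) (Function.update ε₂ i (-ε₁ i)) 0 τ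
      (splitCoord i (r, k)) = c * Complex.exp (Real.pi * Complex.I *
        (2 * (k + ε₂ i / 2) * (τ *ᵥ w) i + (k + ε₂ i / 2) ^ 2 * τ i i
          - (k + ε₂ i / 2) * ε₁ i)) := by
    intro k
    rw [thetaTerm_zero, shifted_splitCoord, hw', quadForm_add_single hτ.1, add_dotProduct, hwe,
      single_dotProduct, ← Complex.exp_add]
    congr 1
    simp only [complexVec, Function.update_self]
    push_cast
    ring
  simp only [hL, hR, tsum_mul_left]
  rw [tsum_exp_inversion (im_apply_self_pos hτ i)]
  ring

theorem neg_I_mul_pow (t : ℂ) (k : ℕ) : (-Complex.I * t) ^ k = eighthRoot (-2 * k) * t ^ k := by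
  have h : -Complex.I = eighthRoot (-2) := by
    have : (Real.pi * Complex.I * ((-2 : ℤ) / 4) : ℂ) = -Real.pi / 2 * Complex.I := by
      push_cast
      ring
    rw [eighthRoot, this, Complex.exp_neg_pi_div_two_mul_I]
  have h' : ∀ k : ℕ, eighthRoot (-2) ^ k = eighthRoot (-2 * k) := by
    intro k
    induction k with
    | zero => simp [eighthRoot]
    | succ k ih =>
      rw [pow_succ, ih, ← eighthRoot_add]
      push_cast
      ring_nf
  rw [mul_pow, h, h']

theorem chi_partialInversion (hg : 3 ≤ g) (i : Fin g) {τ : Matrix (Fin g) (Fin g) ℂ}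
    (hτ : τ ∈ upperHalfSpace g) :
    chi g (act (partialInversion i) τ) = τ i i ^ chiWeight g * chi g τ := by
  let σ : (Fin g → Fin 2) × (Fin g → Fin 2) → (Fin g → Fin 2) × (Fin g → Fin 2) :=
    fun ε => (Function.update ε.1 i (ε.2 i), Function.update ε.2 i (ε.1 i))
  have hσ : ∀ ε ∈ evenChars g, σ ε ∈ evenChars g := by
    intro ε hε
    rw [mem_evenChars] at hε ⊢
    have : lift (σ ε).1 ⬝ᵥ lift (σ ε).2 = lift ε.1 ⬝ᵥ lift ε.2 := by
      refine Finset.sum_congr rfl fun j _ => ?_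
      by_cases h : j = i
      · subst h
        simp [σ, lift, mul_comm]
      · simp [σ, lift, h]
    rwa [this]
  have hσ' : Function.Injective σ := by
    have : Function.Involutive σ := by
      rintro ⟨a, b⟩
      simp [σ]
    exact this.injective
  -- The exponent `-2` is `2 - 4`: the inversion contributes `2`, and replacing the entry `-ε₁ i` of
  -- the new characteristic by `ε₁ i` contributes `-4`.
  rw [chi_eq_of_thetaNull_eq hσ hσ' (τ := τ) fun ε =>
    (-Complex.I * τ i i) ^ (1 / 2 : ℂ) * eighthRoot (-2 * (lift ε.1 i * lift ε.2 i))]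
  · congr 1
    -- The `2k` square roots combine to `(-i τ_ii)^k`, so their branch is irrelevant, and `(-i)^k`
    -- is the eighth root of exponent `-2k`. The total exponent is `-2` times the number in
    -- `four_dvd_chiWeight_add`.
    rw [Finset.prod_mul_distrib, Finset.prod_const, ← two_mul_chiWeight (by omega), pow_mul,
      one_div, Complex.cpow_ofNat_inv_pow, neg_I_mul_pow, eighthRoot_sum, mul_right_comm,
      ← eighthRoot_add, eighthRoot_eq_one, one_mul]
    obtain ⟨m, hm⟩ := four_dvd_chiWeight_add hg i
    refine ⟨-m, ?_⟩
    have hm' := congrArg (Nat.cast : ℕ → ℤ) hm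
    push_cast at hm'
    rw [← Finset.mul_sum]
    simp only [lift]
    linarith
  · intro ε _
    rw [thetaNull_partialInversion i _ _ hτ]
    have h1 : Function.update (lift ε.1) i (lift ε.2 i) = lift (σ ε).1 := by
      ext j
      by_cases h : j = i
      · subst h
        simp [σ, lift]
      · simp [σ, lift, h]
    have h2 : Function.update (lift ε.2) i (-lift ε.1 i)
        = lift (σ ε).2 + (2 : ℤ) • Pi.single i (-lift ε.1 i) := by
      ext j
      by_cases h : j = i
      · subst h
        simp [σ, lift]
        ring
      · simp [σ, lift, h]
    have h3 : lift (σ ε).1 i = lift ε.2 i := by simp [σ, lift]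
    rw [h1, h2, thetaNull_add_two_smul_right, dotProduct_single, h3, ← mul_assoc,
      mul_assoc (_ ^ _), ← eighthRoot_add]
    congr 4
    ring

end PartialInversion

/-! ### Holomorphy of the Thetanullwerte -/

section Holomorphy

/-- The linear form `H ↦ x H x`, on the normed space of families `H i j`. -/
def quadFormCLM (x : Fin g → ℂ) : (Fin g → Fin g → ℂ) →L[ℂ] ℂ :=
  ∑ i, ∑ j, (x i * x j) • (ContinuousLinearMap.proj (R := ℂ) (φ := fun _ : Fin g => ℂ) j).comp
    (ContinuousLinearMap.proj (R := ℂ) (φ := fun _ : Fin g => Fin g → ℂ) i)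

theorem quadFormCLM_apply (x : Fin g → ℂ) (H : Fin g → Fin g → ℂ) :
    quadFormCLM x H = x ⬝ᵥ of H *ᵥ x := by
  simp only [quadFormCLM, dotProduct, mulVec, Finset.mul_sum, _root_.sum_apply,
    _root_.smul_apply, ContinuousLinearMap.comp_apply, ContinuousLinearMap.proj_apply,
    smul_eq_mul, of_apply]
  exact Finset.sum_congr rfl fun i _ => Finset.sum_congr rfl fun j _ => by ring

/-- For the sup norm on entries the form is bounded by `(∑ |x i|)²`; Cauchy–Schwarz gives the factor
`g`. -/
theorem norm_quadFormCLM_le (x : Fin g → ℝ) :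
    ‖quadFormCLM fun i => (x i : ℂ)‖ ≤ g * ∑ i, x i ^ 2 := by
  refine ContinuousLinearMap.opNorm_le_bound _ (by positivity) fun H => ?_
  rw [quadFormCLM_apply]
  calc ‖(fun i => (x i : ℂ)) ⬝ᵥ of H *ᵥ fun i => (x i : ℂ)‖
      ≤ ∑ i, ∑ j, |x i| * |x j| * ‖H‖ := by
        simp only [dotProduct, mulVec, Finset.mul_sum]
        refine (norm_sum_le _ _).trans (Finset.sum_le_sum fun i _ => ?_)
        refine (norm_sum_le _ _).trans (Finset.sum_le_sum fun j _ => ?_)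
        have h : ‖H i j‖ ≤ ‖H‖ := (norm_le_pi_norm (H i) j).trans (norm_le_pi_norm H i)
        rw [norm_mul, norm_mul, Complex.norm_real, Complex.norm_real, of_apply, Real.norm_eq_abs,
          Real.norm_eq_abs]
        calc |x i| * (‖H i j‖ * |x j|) = |x i| * |x j| * ‖H i j‖ := by ring
          _ ≤ _ := by gcongr
    _ = (∑ i, |x i|) ^ 2 * ‖H‖ := by
        simp only [← Finset.sum_mul, ← Finset.mul_sum]
        ring
    _ ≤ g * (∑ i, x i ^ 2) * ‖H‖ := by
        have := sq_sum_le_card_mul_sum_sq (s := Finset.univ) (f := fun i => |x i|)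
        simp only [sq_abs, Finset.card_univ, Fintype.card_fin] at this
        gcongr

theorem im_quadFormCLM (x : Fin g → ℝ) (H : Fin g → Fin g → ℂ) :
    (quadFormCLM (fun i => (x i : ℂ)) H).im = x ⬝ᵥ (of H).map Complex.im *ᵥ x := by
  rw [quadFormCLM_apply]
  simp [dotProduct, mulVec, Complex.im_sum]

/-- `n + ε / 2`, as a real vector. -/
def realShifted (ε n : Fin g → ℤ) : Fin g → ℝ := fun i => (n i : ℝ) + (ε i : ℝ) / 2

theorem ofReal_realShifted (ε n : Fin g → ℤ) :
    (fun i => (realShifted ε n i : ℂ)) = shifted ε n := by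
  ext i
  simp [realShifted, shifted]

theorem norm_thetaTerm_zero (ε₁ ε₂ : Fin g → ℤ) (τ : Fin g → Fin g → ℂ) (n : Fin g → ℤ) :
    ‖thetaTerm ε₁ ε₂ 0 (of τ) n‖
      = Real.exp (-Real.pi * (quadFormCLM (shifted ε₁ n) τ).im) := by
  have h : (shifted ε₁ n ⬝ᵥ complexVec ε₂).im = 0 := by
    rw [← ofReal_realShifted]
    simp [dotProduct, complexVec, Complex.im_sum]
  rw [thetaTerm_zero, Complex.norm_exp, quadFormCLM_apply]
  congr 1
  have h4 : ∀ w : ℂ, (Real.pi * Complex.I * w).re = -Real.pi * w.im := by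
    intro w
    simp
  rw [h4, Complex.add_im, h, add_zero]

theorem summable_exp_neg_sum_sq {c : ℝ} (hc : 0 < c) (ε : Fin g → ℤ) :
    Summable fun n : Fin g → ℤ => Real.exp (-Real.pi * (c * ∑ i, realShifted ε n i ^ 2)) := by
  refine (summable_prod_apply (F := fun i (n : ℤ) =>
    Real.exp (-Real.pi * (c * (n + (ε i : ℝ) / 2) ^ 2 + 2 * ((n + (ε i : ℝ) / 2) * 0))))
    (fun _ _ => (Real.exp_pos _).le) fun i => summable_exp_quadratic hc _ _).congr fun n => ?_
  rw [← Real.exp_sum, ← Finset.mul_sum, Finset.mul_sum _ _ c]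
  simp [realShifted]

theorem hasFDerivAt_thetaTerm (ε₁ ε₂ n : Fin g → ℤ) (τ : Fin g → Fin g → ℂ) :
    HasFDerivAt (fun τ : Fin g → Fin g → ℂ => thetaTerm ε₁ ε₂ 0 (of τ) n)
      (thetaTerm ε₁ ε₂ 0 (of τ) n • (Real.pi * Complex.I : ℂ) • quadFormCLM (shifted ε₁ n)) τ := by
  simp only [thetaTerm_zero, ← quadFormCLM_apply]
  exact (((quadFormCLM (shifted ε₁ n)).hasFDerivAt.add_const _).const_mul _).cexp

/-- Only the positivity of the imaginary part of the quadratic form matters, and it persists on a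
ball in the space of all matrices, symmetric or not. The series is differentiated termwise there. -/
theorem differentiableAt_thetaNull (ε₁ ε₂ : Fin g → ℤ) {τ : Fin g → Fin g → ℂ}
    (hτ : of τ ∈ upperHalfSpace g) :
    DifferentiableAt ℂ (fun τ : Fin g → Fin g → ℂ => thetaNull ε₁ ε₂ (of τ)) τ := by
  obtain ⟨c, hc, hle⟩ := exists_quadForm_lower_bound hτ.2
  -- Moving `τ` by at most `r` changes the form by at most `r g ∑ xᵢ²`, which is at most half of its
  -- lower bound `c ∑ xᵢ²`.
  set r : ℝ := c / (2 * (g + 1)) with hr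
  have hr0 : 0 < r := by positivity
  have hrg : r * g ≤ c / 2 := by
    rw [hr, div_mul_eq_mul_div, div_le_div_iff₀ (by positivity) two_pos]
    nlinarith
  have hball : ∀ σ ∈ Metric.ball τ r, ∀ n : Fin g → ℤ,
      c / 2 * ∑ i, realShifted ε₁ n i ^ 2 ≤ (quadFormCLM (shifted ε₁ n) σ).im := by
    intro σ hσ n
    set q := ∑ i, realShifted ε₁ n i ^ 2 with hq
    have hq0 : 0 ≤ q := by positivity
    have h1 : c * q ≤ (quadFormCLM (shifted ε₁ n) τ).im := by
      rw [← ofReal_realShifted]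
      exact (hle _).trans_eq (im_quadFormCLM _ τ).symm
    have h2 : ‖quadFormCLM (shifted ε₁ n) (σ - τ)‖ ≤ g * q * r := by
      refine (ContinuousLinearMap.le_opNorm _ _).trans ?_
      rw [← ofReal_realShifted]
      have := norm_quadFormCLM_le (realShifted ε₁ n)
      have h3 : ‖σ - τ‖ ≤ r := (mem_ball_iff_norm.mp hσ).le
      gcongr
    have h3 := (Complex.abs_im_le_norm _).trans h2
    rw [map_sub, Complex.sub_im] at h3
    have h4 := (abs_le.mp h3).1
    nlinarith [mul_le_mul_of_nonneg_right hrg hq0]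
  have key := hasFDerivAt_tsum_of_isPreconnected (𝕜 := ℂ) (x₀ := τ) (x := τ)
    ((summable_exp_neg_sum_sq (c := c / 4) (by positivity) ε₁).mul_left (4 * g / c))
    (Metric.isOpen_ball (x := τ) (ε := r)) (convex_ball τ r).isPreconnected
    (fun n σ _ => hasFDerivAt_thetaTerm ε₁ ε₂ n σ) (fun n σ hσ => ?_)
    (Metric.mem_ball_self hr0) (summable_thetaTerm ε₁ ε₂ 0 hτ) (Metric.mem_ball_self hr0)
  · exact key.differentiableAt
  · have h1 := hball σ hσ n
    set q := ∑ i, realShifted ε₁ n i ^ 2 with hq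
    have h2 : ‖quadFormCLM (shifted ε₁ n)‖ ≤ g * q := by
      rw [← ofReal_realShifted]
      exact norm_quadFormCLM_le _
    -- The polynomial factor from the derivative is absorbed by half of the Gaussian decay `exp (-π
    -- c q / 2)`.
    have h3 : q ≤ 4 / (Real.pi * c) * Real.exp (Real.pi * (c / 4 * q)) := by
      have := (Real.add_one_le_exp (Real.pi * (c / 4 * q)))
      rw [div_mul_eq_mul_div, le_div_iff₀ (by positivity)]
      linarith
    rw [norm_smul, norm_smul, norm_thetaTerm_zero, norm_mul, Complex.norm_I, mul_one,
      Complex.norm_real, Real.norm_of_nonneg Real.pi_pos.le]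
    calc Real.exp (-Real.pi * (quadFormCLM (shifted ε₁ n) σ).im)
          * (Real.pi * ‖quadFormCLM (shifted ε₁ n)‖)
        ≤ Real.exp (-Real.pi * (c / 2 * q)) * (Real.pi * (g * q)) := by
          gcongr ?_ * (_ * ?_)
          refine Real.exp_le_exp.mpr ?_
          nlinarith [Real.pi_pos]
      _ ≤ Real.exp (-Real.pi * (c / 2 * q)) *
          (Real.pi * (g * (4 / (Real.pi * c) * Real.exp (Real.pi * (c / 4 * q))))) := by
          gcongr
      _ = 4 * g / c *
          (Real.exp (-Real.pi * (c / 2 * q)) * Real.exp (Real.pi * (c / 4 * q))) := by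
          field_simp
      _ = 4 * g / c * Real.exp (-Real.pi * (c / 4 * q)) := by
          rw [← Real.exp_add]
          ring_nf

end Holomorphy

theorem smul_mem_upperHalfSpace {τ : Matrix (Fin g) (Fin g) ℂ} (hτ : τ ∈ upperHalfSpace g) :
    (1 / 2 : ℂ) • τ ∈ upperHalfSpace g := by
  refine ⟨hτ.1.smul _, ?_⟩
  have : ((1 / 2 : ℂ) • τ).map Complex.im = (1 / 2 : ℝ) • τ.map Complex.im := by
    ext i j
    simp
  rw [this]
  exact hτ.2.smul (by norm_num)

theorem differentiableOn_chi_half :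
    DifferentiableOn ℂ (fun τ => chi g ((1 / 2 : ℂ) • τ)) (upperHalfSpace g) := by
  have h : ∀ τ : Fin g → Fin g → ℂ, of τ ∈ upperHalfSpace g →
      DifferentiableAt ℂ (fun τ : Fin g → Fin g → ℂ => chi g (of ((1 / 2 : ℂ) • τ))) τ := by
    intro τ hτ
    simp only [chi]
    refine (HasFDerivAt.finsetProd fun ε _ => DifferentiableAt.hasFDerivAt (𝕜 := ℂ)
      ?_).differentiableAt
    exact (differentiableAt_thetaNull (lift ε.1) (lift ε.2) (τ := (1 / 2 : ℂ) • τ)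
      (smul_mem_upperHalfSpace hτ)).comp τ (differentiableAt_id.const_smul (1 / 2 : ℂ))
  exact fun τ hτ => (h τ hτ).differentiableWithinAt

/-! ### Modularity for the full group and passage to the congruence subgroup -/

theorem denom_one (τ : Matrix (Fin g) (Fin g) ℂ) : denom 1 τ = 1 := by
  have hC : blockC (1 : siegelModularGroup g) = 0 := by
    ext i j
    simp [blockC, toBlocks₂₁]
  have hD : blockD (1 : siegelModularGroup g) = 1 := by
    ext i j
    simp [blockD, toBlocks₂₂, Matrix.one_apply]
  simp [denom, hC, hD]

theorem act_one (τ : Matrix (Fin g) (Fin g) ℂ) : act 1 τ = τ := by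
  have hA : blockA (1 : siegelModularGroup g) = 1 := by
    ext i j
    simp [blockA, toBlocks₁₁, Matrix.one_apply]
  have hB : blockB (1 : siegelModularGroup g) = 0 := by
    ext i j
    simp [blockB, toBlocks₁₂]
  simp [act, num, denom_one, hA, hB]

theorem autFactor_one (τ : Matrix (Fin g) (Fin g) ℂ) : autFactor 1 τ = 1 := by
  rw [autFactor, denom_one, det_one]

/-- The stabilizer of `χ_k` under the slash action of weight `k`. -/
def chiStabilizer (g : ℕ) : Subgroup (siegelModularGroup g) where
  carrier := {M | ∀ τ ∈ upperHalfSpace g, chi g (act M τ) = autFactor M τ ^ chiWeight g * chi g τ}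
  one_mem' := fun τ _ => by rw [act_one, autFactor_one, one_pow, one_mul]
  mul_mem' := by
    intro M N hM hN τ hτ
    have hu := isUnit_det_denom N hτ
    rw [act_mul M N τ hu, hM _ (act_mem N hτ), hN τ hτ, autFactor_mul M N τ hu, mul_pow, mul_assoc]
  inv_mem' := by
    intro M hM τ hτ
    have hu := isUnit_det_denom M⁻¹ hτ
    have h1 := hM _ (act_mem M⁻¹ hτ)
    rw [← act_mul M M⁻¹ τ hu] at h1
    have h2 := autFactor_mul M M⁻¹ τ hu
    rw [mul_inv_cancel, act_one] at h1
    rw [mul_inv_cancel, autFactor_one] at h2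
    rw [h1, ← mul_assoc, ← mul_pow, mul_comm (autFactor M⁻¹ τ), ← h2, one_pow, one_mul]

theorem chi_act (hg : 3 ≤ g) (M : siegelModularGroup g) {τ : Matrix (Fin g) (Fin g) ℂ}
    (hτ : τ ∈ upperHalfSpace g) :
    chi g (act M τ) = autFactor M τ ^ chiWeight g * chi g τ := by
  refine mem_of_generators_mem (K := chiStabilizer g) ?_ ?_ ?_ M τ hτ
  · intro S hS τ _
    rw [act_translation, autFactor_translation, chi_add_intCast hg S hS, one_pow, one_mul]
  · intro U τ _
    rw [act_levi, autFactor_levi_pow U τ (even_chiWeight hg), chi_levi U hg, one_mul]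
  · intro i τ hτ
    rw [chi_partialInversion hg i hτ, autFactor_partialInversion]

theorem exists_act_half {M : siegelModularGroup g} (hM : M ∈ Gamma0Upper g) :
    ∃ N : siegelModularGroup g, ∀ τ, act N ((1 / 2 : ℂ) • τ) = (1 / 2 : ℂ) • act M τ ∧
      autFactor N ((1 / 2 : ℂ) • τ) = autFactor M τ := by
  choose B hB using hM
  have hB' : blockB M = (2 : ℤ) • of B := by
    ext i j
    exact hB i j
  obtain ⟨h1, h2, h3⟩ := blocks_row_relations M
  rw [hB'] at h1 h3
  rw [transpose_smul, Matrix.mul_smul, Matrix.smul_mul] at h1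
  -- The factor `2` moves from `B` to `C`, so `B Cᵀ` is unchanged; the symmetry of `A Bᵀ` survives
  -- division by `2`.
  let N : siegelModularGroup g := ofBlocks (blockA M) (of B) ((2 : ℤ) • blockC M) (blockD M)
    (smul_right_injective _ (two_ne_zero (α := ℤ)) h1)
    (by rw [transpose_smul, Matrix.mul_smul, Matrix.smul_mul, h2])
    (by rwa [transpose_smul, Matrix.mul_smul, ← Matrix.smul_mul])
  have hd : ∀ τ, denom N ((1 / 2 : ℂ) • τ) = denom M τ := by
    intro τ
    have e : blockC N = (2 : ℤ) • blockC M := rfl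
    have e' : ((2 : ℤ) • blockC M).map (Int.cast : ℤ → ℂ)
        = (2 : ℂ) • (blockC M).map (Int.cast : ℤ → ℂ) := by
      ext i j
      rw [map_apply, Matrix.smul_apply, Matrix.smul_apply, map_apply, smul_eq_mul, smul_eq_mul,
        Int.cast_mul, Int.cast_ofNat]
    rw [denom, e, e', Matrix.smul_mul, Matrix.mul_smul, smul_smul, mul_one_div_cancel two_ne_zero,
      one_smul]
    rfl
  have hn : ∀ τ, num N ((1 / 2 : ℂ) • τ) = (1 / 2 : ℂ) • num M τ := by
    intro τ
    have e : blockB N = of B := rfl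
    have e' : (blockB M).map (Int.cast : ℤ → ℂ) = (2 : ℂ) • (of B).map (Int.cast : ℤ → ℂ) := by
      rw [hB']
      ext i j
      simp
    rw [num, num, e, e', Matrix.mul_smul, smul_add, smul_smul, one_div_mul_cancel two_ne_zero,
      one_smul]
    rfl
  refine ⟨N, fun τ => ⟨?_, ?_⟩⟩
  · rw [act, hd, hn, act, Matrix.smul_mul]
  · rw [autFactor, hd, autFactor]

end SiegelTheta

end

theorem mainTheorem6 (g : ℕ) (hg : 3 ≤ g) :
    SiegelTheta.IsSiegelModularForm (SiegelTheta.Gamma0Upper g) (SiegelTheta.chiWeight g)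
      (fun τ => SiegelTheta.chi g ((1 / 2 : ℂ) • τ)) := by
  refine ⟨SiegelTheta.differentiableOn_chi_half, fun M hM τ hτ => ?_⟩
  obtain ⟨N, hN⟩ := SiegelTheta.exists_act_half hM
  obtain ⟨h1, h2⟩ := hN τ
  rw [← h1, SiegelTheta.chi_act hg N (SiegelTheta.smul_mem_upperHalfSpace hτ), h2]
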